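/- Let $m\ge 2$ and let $S_1,\dots,S_m$ be affine contractions of $[0,1]$ onto non-degenerate closed segments $I_i=S_i([0,1])\subset[0,1]$ with pairwise disjoint interiors and $\sum_{i=1}^m|I_i|<1$. Let $\rho_1,\dots,\rho_m>0$ with $\sum_i\rho_i=1$, and let $\mu_0$ be the self-similar measure generated by them, i.e. the Borel probability measure on $[0,1]$ with $\mu_0(E)=\sum_i\rho_i\,\mu_0(S_i^{-1}(E))$ for all Borel $E$. Let $g:[0,1]\to[0,1]$ be a $C^1$ diffeomorphism onto $[0,1]$, let $\mu=\mu_0\circ g$ be the deformed self-similar measure $\mu(E)=\mu_0(g(E))$, put $\varphi_i=g^{-1}\circ S_i\circ g$, and let $x_i\in[0,1]$ be the fixed point of $\varphi_i$. Let $N(\lambda,\mu)$ be the number (with multiplicity) of eigenvalues smaller than $\lambda$ of the Neumann problem $-y''=\lambda\mu y$, $y'(0)=y'(1)=0$, understood in the generalized sense: $y\in W_2^1[0,1]$, $y\neq 0$, and $\int_0^1 y'\eta'\,dx=\lambda\int_0^1 y\eta\,d\mu$ for all $\eta\in W_2^1[0,1]$. Then $\varphi_i$ is differentiable at $x_i$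 (one-sidedly if $x_i$ is an endpoint) with $|\varphi_i'(x_i)|=|I_i|$ for every $i$; the equation $$\sum_{i=1}^m\bigl(\rho_i|\varphi_i'(x_i)|\bigr)^D=1$$ has exactly one real solution $D$, this solution satisfies $0<D<\tfrac12$, and $$N(\lambda,\mu)\asymp\lambda^D,$$ i.e. there are constants $C_1,C_2>0$ such that $C_1\lambda^D\le N(\lambda,\mu)$ for all $\lambda\ge 0$ and $N(\lambda,\mu)\le C_2\lambda^D$ for all $\lambda\ge 1$. -/

import Mathlib

open MeasureTheory Set
open scoped ENNReal

/-! ### The Neumann problem `-y'' = lam μ y`, `y'(0) = y'(1) = 0` on `[0, 1]` -/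

/-- The Sobolev space `W_2^1[0, 1]`: absolutely continuous functions on `[0, 1]` whose (almost
everywhere defined) derivative is square integrable. Only the values on `[0, 1]` matter. -/
def MemW12 (y : ℝ → ℝ) : Prop :=
  AbsolutelyContinuousOnInterval y 0 1 ∧ MemLp (deriv y) 2 (volume.restrict (Icc (0 : ℝ) 1))

/-- `y` is a generalized solution, for the spectral parameter `lam`, of the formal boundary value
problem `-y'' = lam μ y`, `y'(0) = y'(1) = 0`. -/
def IsGeneralizedSolution (μ : Measure ℝ) (lam : ℝ) (y : ℝ → ℝ) : Prop :=
  MemW12 y ∧ ∀ η : ℝ → ℝ, MemW12 η →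
    ∫ x in (0 : ℝ)..1, deriv y x * deriv η x = lam * ∫ x in Icc (0 : ℝ) 1, y x * η x ∂μ

theorem MemW12.add {y z : ℝ → ℝ} (hy : MemW12 y) (hz : MemW12 z) :
    MemW12 (y + z) ∧
      deriv (y + z) =ᵐ[volume.restrict (Icc (0 : ℝ) 1)] fun x => deriv y x + deriv z x := by
  have h : deriv (y + z) =ᵐ[volume.restrict (Icc (0 : ℝ) 1)]
      fun x => deriv y x + deriv z x := by
    rw [Filter.EventuallyEq, ae_restrict_iff' measurableSet_Icc]
    filter_upwards [hy.1.ae_differentiableAt, hz.1.ae_differentiableAt] with x h1 h2 hx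
    rw [← uIcc_of_le (zero_le_one' ℝ)] at hx
    exact deriv_add (h1 hx) (h2 hx)
  exact ⟨⟨hy.1.add hz.1, (memLp_congr_ae h).2 (hy.2.add hz.2)⟩, h⟩

theorem MemW12.smul {y : ℝ → ℝ} (c : ℝ) (hy : MemW12 y) :
    MemW12 (c • y) ∧ deriv (c • y) = fun x => c * deriv y x := by
  have h : deriv (c • y) = fun x => c * deriv y x := by
    funext x
    exact deriv_const_mul_field c
  exact ⟨⟨hy.1.const_smul c, by rw [h]; exact hy.2.const_mul c⟩, h⟩

theorem MemW12.integrable_deriv_mul {y z : ℝ → ℝ} (hy : MemW12 y) (hz : MemW12 z) :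
    IntervalIntegrable (fun x => deriv y x * deriv z x) volume 0 1 := by
  rw [intervalIntegrable_iff_integrableOn_Icc_of_le zero_le_one]
  exact hy.2.integrable_mul hz.2

theorem MemW12.integrable_mul (μ : Measure ℝ) [IsFiniteMeasure μ] {y z : ℝ → ℝ}
    (hy : MemW12 y) (hz : MemW12 z) :
    IntegrableOn (fun x => y x * z x) (Icc (0 : ℝ) 1) μ := by
  have h := hy.1.continuousOn.mul hz.1.continuousOn
  rw [uIcc_of_le (zero_le_one' ℝ)] at h
  exact h.integrableOn_compact isCompact_Icc

theorem IsGeneralizedSolution.zero (μ : Measure ℝ) (lam : ℝ) :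
    IsGeneralizedSolution μ lam 0 := by
  refine ⟨⟨(LipschitzWith.const (0 : ℝ)).lipschitzOnWith.absolutelyContinuousOnInterval, ?_⟩,
    fun η _ => ?_⟩
  · have : deriv (0 : ℝ → ℝ) = 0 := by
      funext x
      simp
    rw [this]
    exact MemLp.zero
  · simp

theorem IsGeneralizedSolution.add (μ : Measure ℝ) [IsFiniteMeasure μ] {lam : ℝ} {y z : ℝ → ℝ}
    (hy : IsGeneralizedSolution μ lam y) (hz : IsGeneralizedSolution μ lam z) :
    IsGeneralizedSolution μ lam (y + z) := by
  obtain ⟨h1, h2⟩ := hy.1.add hz.1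
  refine ⟨h1, fun η hη => ?_⟩
  have e1 : ∫ x in (0 : ℝ)..1, deriv (y + z) x * deriv η x =
      ∫ x in (0 : ℝ)..1, (deriv y x * deriv η x + deriv z x * deriv η x) := by
    rw [intervalIntegral.integral_of_le zero_le_one, intervalIntegral.integral_of_le zero_le_one]
    refine integral_congr_ae ?_
    filter_upwards [ae_restrict_of_ae_restrict_of_subset Ioc_subset_Icc_self h2] with x hx
    rw [hx, add_mul]
  have e2 : ∫ x in Icc (0 : ℝ) 1, (y + z) x * η x ∂μ =
      ∫ x in Icc (0 : ℝ) 1, (y x * η x + z x * η x) ∂μ := by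
    simp only [Pi.add_apply, add_mul]
  rw [e1, e2, intervalIntegral.integral_add (hy.1.integrable_deriv_mul hη)
    (hz.1.integrable_deriv_mul hη), integral_add (hy.1.integrable_mul μ hη)
    (hz.1.integrable_mul μ hη), hy.2 η hη, hz.2 η hη, mul_add]

theorem IsGeneralizedSolution.smul {μ : Measure ℝ} {lam : ℝ} {y : ℝ → ℝ} (c : ℝ)
    (hy : IsGeneralizedSolution μ lam y) : IsGeneralizedSolution μ lam (c • y) := by
  obtain ⟨h1, h2⟩ := hy.1.smul c
  refine ⟨h1, fun η hη => ?_⟩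
  have := hy.2 η hη
  simp only [h2, Pi.smul_apply, smul_eq_mul, mul_assoc, intervalIntegral.integral_const_mul,
    integral_const_mul, this]
  ring

/-- The space of generalized solutions on `[0, 1]` for the spectral parameter `lam`, as a space of
functions on `[0, 1]`; `lam` is an eigenvalue when it is nonzero. -/
def eigenspaceNeumann (μ : Measure ℝ) [IsFiniteMeasure μ] (lam : ℝ) :
    Submodule ℝ (Icc (0 : ℝ) 1 → ℝ) where
  carrier := {f | IsGeneralizedSolution μ lam (IccExtend zero_le_one f)}
  zero_mem' := IsGeneralizedSolution.zero μ lam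
  add_mem' := fun hf hg => IsGeneralizedSolution.add μ hf hg
  smul_mem' := fun c _ hf => IsGeneralizedSolution.smul c hf

/-- The multiplicity of `lam` as an eigenvalue (zero if it is not an eigenvalue). -/
noncomputable def eigenvalueMultiplicity (μ : Measure ℝ) [IsFiniteMeasure μ] (lam : ℝ) : ℕ∞ :=
  Cardinal.toENat (Module.rank ℝ (eigenspaceNeumann μ lam))

/-- The counting function `N(lam, μ)`: the number of eigenvalues smaller than `lam`. An eigenvalue
`ν` of multiplicity `k` contributes the `k` labels `(ν, 0), …, (ν, k - 1)`. -/
noncomputable def eigenvalueCount (μ : Measure ℝ) [IsFiniteMeasure μ] (lam : ℝ) : ℕ∞ :=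
  Set.encard {p : ℝ × ℕ | p.1 < lam ∧ (p.2 : ℕ∞) < eigenvalueMultiplicity μ p.1}

/-! ### Self-similar measures and their deformations -/

/-- Affine contractions `S_i x = ratio i * x + shift i` of `[0, 1]` onto non-overlapping
subsegments `I_i` (which may touch at endpoints) of total length less than one, with weights.
Here `|ratio i|` is the length of `I_i`. -/
structure AffineIFS (m : ℕ) where
  ratio : Fin m → ℝ
  shift : Fin m → ℝ
  weight : Fin m → ℝ
  two_le : 2 ≤ m
  ratio_ne_zero : ∀ i, ratio i ≠ 0
  mapsTo : ∀ i, MapsTo (fun x => ratio i * x + shift i) (Icc 0 1) (Icc 0 1)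
  disjoint : Pairwise fun i j => Disjoint
    ((fun x => ratio i * x + shift i) '' Ioo 0 1) ((fun x => ratio j * x + shift j) '' Ioo 0 1)
  sum_abs_ratio_lt_one : ∑ i, |ratio i| < 1
  weight_pos : ∀ i, 0 < weight i
  sum_weight : ∑ i, weight i = 1

/-- The affine map `S_i`. -/
def AffineIFS.map {m : ℕ} (F : AffineIFS m) (i : Fin m) (x : ℝ) : ℝ :=
  F.ratio i * x + F.shift i

/-- `μ₀` is the self-similar measure generated by the system: the Borel probability measure on
`[0, 1]` with `μ₀(E) = ∑ ρ_i μ₀(S_i⁻¹(E))`. -/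
structure AffineIFS.IsSelfSimilarMeasure {m : ℕ} (F : AffineIFS m) (μ₀ : Measure ℝ) : Prop where
  measure_univ : μ₀ univ = 1
  measure_compl : μ₀ (Icc 0 1)ᶜ = 0
  invariant : ∀ E : Set ℝ, MeasurableSet E →
    μ₀ E = ∑ i, ENNReal.ofReal (F.weight i) * μ₀ (F.map i ⁻¹' E)

/-- `g` is a `C^1` diffeomorphism of `[0, 1]` onto itself with inverse `h`. -/
structure IsC1Diffeo (g h : ℝ → ℝ) : Prop where
  mapsTo : MapsTo g (Icc 0 1) (Icc 0 1)
  mapsTo_inv : MapsTo h (Icc 0 1) (Icc 0 1)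
  leftInv : LeftInvOn h g (Icc 0 1)
  rightInv : RightInvOn h g (Icc 0 1)
  contDiffOn : ContDiffOn ℝ 1 g (Icc 0 1)
  contDiffOn_inv : ContDiffOn ℝ 1 h (Icc 0 1)

/-- `μ = μ₀ ∘ g`: the measure on `[0, 1]` with `μ(E) = μ₀(g(E))`. -/
structure IsDeformedMeasure (μ₀ : Measure ℝ) (g : ℝ → ℝ) (μ : Measure ℝ) : Prop where
  measure_compl : μ (Icc 0 1)ᶜ = 0
  measure_eq : ∀ E : Set ℝ, E ⊆ Icc 0 1 → MeasurableSet E → μ E = μ₀ (g '' E)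

/-- The deformed map `φ_i = g⁻¹ ∘ S_i ∘ g`, where `h = g⁻¹`. -/
def AffineIFS.deformedMap {m : ℕ} (F : AffineIFS m) (g h : ℝ → ℝ) (i : Fin m) : ℝ → ℝ :=
  h ∘ F.map i ∘ g

/-! The eigenvalues are governed by the Rayleigh quotient of energy `∫ y'²` to mass `∫ y² dμ`, so
counting them reduces to two variational comparisons. If `lam` times the mass is at most the energy
on the common kernel of `n` functionals, at most `n` eigenvalues lie below `lam`; this is linear
algebra (`encard_pairLabels_le`). If the energy is less than `lam` times the mass on an
`n`-dimensional space, at least `n` eigenvalues lie below `lam` (`le_eigenvalueCount`); this needs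
enough eigenfunctions, supplied by the spectral theorem for the compact operator `neumannOperator`.

Give a cell of weight `ρ` and length `|a|` the scale `ρ |a|`. Subdividing `[0, 1]` by the maps `S_i`
and stopping each branch once its scale is at most `ε` yields cells of scales in `(δ ε, ε]`. Scales
multiply along branches, so the sum of their `D`-th powers stays equal to one, and the number of
cells is comparable to `ε ^ (-D)` (`exists_isCellSystem`).

A function vanishing at one point of every cell has mass at most a constant times `ε` times its
energy (`massForm_le_energyForm`), while a tent on a cell has energy of order at most `1 / |a|` and
mass of order at least `ρ` (`card_le_eigenvalueCount`). Taking `ε` of order `1 / lam` makes both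
counts of order `lam ^ D`. The deformation only costs powers of a bi-Lipschitz constant `K`, since
`μ` is the image of `μ₀` under `g⁻¹`.

The multiplier of `φ_i` at its fixed point is that of `S_i`, because differentiable conjugation
preserves it. The sum of the `s`-th powers of the scales strictly decreases in `s`, equals `m > 1`
at `s = 0`, and is below one at `s = 1/2` by Cauchy–Schwarz. -/

/-! ### Generalized eigenspaces of a pair of symmetric forms -/

section FormPair

variable {X : Type*} [AddCommGroup X] [Module ℝ X]

/-- The solutions `y` of `A y η = ν B y η` for all `η`. -/
def pairEigenspace (A B : X →ₗ[ℝ] X →ₗ[ℝ] ℝ) (ν : ℝ) : Submodule ℝ X :=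
  LinearMap.ker (A - ν • B)

theorem mem_pairEigenspace {A B : X →ₗ[ℝ] X →ₗ[ℝ] ℝ} {ν : ℝ} {y : X} :
    y ∈ pairEigenspace A B ν ↔ ∀ η, A y η = ν * B y η := by
  simp [pairEigenspace, LinearMap.ext_iff, sub_eq_zero]

theorem pairEigenspace_orthogonal {A B : X →ₗ[ℝ] X →ₗ[ℝ] ℝ} (hA : ∀ y z, A y z = A z y)
    (hB : ∀ y z, B y z = B z y) {ν ν' : ℝ} (h : ν ≠ ν') {y z : X}
    (hy : y ∈ pairEigenspace A B ν) (hz : z ∈ pairEigenspace A B ν') : B y z = 0 := by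
  have h1 := mem_pairEigenspace.1 hy z
  have h2 := mem_pairEigenspace.1 hz y
  rw [hA z y, hB z y, h1] at h2
  have h3 : (ν - ν') * B y z = 0 := by linarith
  exact (mul_eq_zero.1 h3).resolve_left (sub_ne_zero.2 h)

/-- The labels `(ν, k)` of the eigenvalues `ν < lam` counted with multiplicity. -/
def pairLabels (A B : X →ₗ[ℝ] X →ₗ[ℝ] ℝ) (lam : ℝ) : Set (ℝ × ℕ) :=
  {p | p.1 < lam ∧ (p.2 : ℕ∞) < Cardinal.toENat (Module.rank ℝ (pairEigenspace A B p.1))}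

/-- If `lam B ≤ A` on the common kernel of `n` functionals, there are at most `n` eigenvalues
smaller than `lam`. -/
theorem encard_pairLabels_le {A B : X →ₗ[ℝ] X →ₗ[ℝ] ℝ} (hA : ∀ y z, A y z = A z y)
    (hB : ∀ y z, B y z = B z y) (hB0 : ∀ y, 0 ≤ B y y)
    (hAB : ∀ y, A y y = 0 → B y y = 0 → y = 0) {lam : ℝ} {ι : Type*} [Fintype ι]
    (l : ι → X →ₗ[ℝ] ℝ) (hl : ∀ y, (∀ i, l i y = 0) → lam * B y y ≤ A y y) :
    (pairLabels A B lam).encard ≤ Fintype.card ι := by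
  classical
  by_contra! hlt
  obtain ⟨F₀, hF₀, hcard⟩ := Set.exists_subset_encard_eq (Order.add_one_le_of_lt hlt)
  have hfin : F₀.Finite := by
    rw [← Set.encard_lt_top_iff, hcard]
    exact_mod_cast ENat.natCast_lt_top _
  lift F₀ to Finset (ℝ × ℕ) using hfin with F
  rw [Set.encard_coe_eq_coe_finsetCard] at hcard
  have hcard' : F.card = Fintype.card ι + 1 := by exact_mod_cast hcard
  let V : Finset ℝ := F.image Prod.fst
  -- Eigenspaces are not known to be finite-dimensional here, so only `r ν` independent eigenvectors
  -- are used: one more than the largest chosen label at `ν`.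
  let r : ℝ → ℕ := fun ν => (F.filter fun p => p.1 = ν).sup fun p => p.2 + 1
  have hr : ∀ ν, (r ν : Cardinal) ≤ Module.rank ℝ (pairEigenspace A B ν) := by
    intro ν
    rcases (F.filter fun p => p.1 = ν).eq_empty_or_nonempty with h | h
    · simp [r, h]
    · obtain ⟨p, hp, hpe⟩ := Finset.exists_mem_eq_sup _ h fun p : ℝ × ℕ => p.2 + 1
      rw [Finset.mem_filter] at hp
      have h2 := (hF₀ hp.1).2
      rw [hp.2] at h2
      have h3 : ((p.2 + 1 : ℕ) : ℕ∞) ≤ Cardinal.toENat (Module.rank ℝ (pairEigenspace A B ν)) := by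
        push_cast
        exact Order.add_one_le_of_lt h2
      rw [show r ν = p.2 + 1 from hpe]
      exact Cardinal.natCast_le_toENat.1 h3
  choose f hf using fun ν => Module.le_rank_iff_exists_linearMap.1 (hr ν)
  have hsum : F.card ≤ ∑ ν : V, r ν := by
    rw [Finset.sum_coe_sort V r]
    have : F.card ≤ (V.sigma fun ν => Finset.range (r ν)).card := by
      refine Finset.card_le_card_of_injOn (fun p => ⟨p.1, p.2⟩) (fun p hp => ?_) ?_
      · simp only [Finset.coe_sigma, Set.mem_sigma_iff, Finset.mem_coe, Finset.mem_range]
        refine ⟨Finset.mem_image_of_mem _ hp, ?_⟩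
        exact Finset.le_sup (f := fun p : ℝ × ℕ => p.2 + 1)
          (Finset.mem_filter.2 ⟨hp, rfl⟩ : p ∈ F.filter fun q => q.1 = p.1)
      · rintro ⟨a, b⟩ _ ⟨c, d⟩ _ h
        simpa using h
    simpa using this
  let G : (Π ν : V, Fin (r ν) → ℝ) →ₗ[ℝ] X :=
    ∑ ν : V, (pairEigenspace A B (ν : ℝ)).subtype ∘ₗ f ν ∘ₗ LinearMap.proj ν
  -- The coefficient space has dimension at least `Fintype.card ι + 1`, so some nonzero combination
  -- is killed by every `l i`.
  have hker : LinearMap.ker ((LinearMap.pi l) ∘ₗ G) ≠ ⊥ := by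
    apply LinearMap.ker_ne_bot_of_finrank_lt
    rw [Module.finrank_fintype_fun_eq_card, Module.finrank_pi_fintype]
    simp only [Module.finrank_fintype_fun_eq_card, Fintype.card_fin]
    omega
  obtain ⟨c, hc, hc0⟩ := (Submodule.ne_bot_iff _).1 hker
  apply hc0
  let y : V → X := fun ν => f ν (c ν)
  have hG : G c = ∑ ν, y ν := by simp [G, y]
  have hy : ∀ ν : V, y ν ∈ pairEigenspace A B (ν : ℝ) := fun ν => (f ν (c ν)).2
  have hBy : ∀ ν ν' : V, ν ≠ ν' → B (y ν) (y ν') = 0 := fun ν ν' h =>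
    pairEigenspace_orthogonal hA hB (fun h' => h (Subtype.ext h')) (hy ν) (hy ν')
  have h1 := hl (G c) (fun i => congrFun (LinearMap.mem_ker.1 hc) i)
  have hexp : ∀ C : X →ₗ[ℝ] X →ₗ[ℝ] ℝ, C (G c) (G c) = ∑ ν, C (y ν) (G c) := fun C => by
    conv_lhs => enter [1]; rw [hG, map_sum]
    rw [LinearMap.sum_apply]
  have hBB : B (G c) (G c) = ∑ ν, B (y ν) (y ν) := by
    rw [hexp]
    refine Finset.sum_congr rfl fun ν _ => ?_
    rw [hG, map_sum]
    exact Finset.sum_eq_single ν (fun ν' _ h => hBy ν ν' h.symm) (by simp)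
  have hAA : A (G c) (G c) = ∑ ν : V, (ν : ℝ) * B (y ν) (y ν) := by
    rw [hexp]
    refine Finset.sum_congr rfl fun ν _ => ?_
    rw [mem_pairEigenspace.1 (hy ν), hG, map_sum]
    congr 1
    exact Finset.sum_eq_single ν (fun ν' _ h => hBy ν ν' h.symm) (by simp)
  have hlt : ∀ ν : V, (ν : ℝ) < lam := by
    rintro ⟨ν, hν⟩
    obtain ⟨p, hp, rfl⟩ := Finset.mem_image.1 hν
    exact (hF₀ hp).1
  -- Both forms are diagonal on the components `y ν`. As `ν < lam`, the sum has nonnegative terms,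
  -- so every component has zero `B`-form and hence zero `A`-form.
  have hs : ∑ ν : V, (lam - ν) * B (y ν) (y ν) ≤ 0 := by
    rw [hBB, hAA, Finset.mul_sum, ← sub_nonpos, ← Finset.sum_sub_distrib] at h1
    simpa only [sub_mul] using h1
  have hnn : ∀ ν ∈ (Finset.univ : Finset V), 0 ≤ (lam - ν) * B (y ν) (y ν) := fun ν _ =>
    mul_nonneg (sub_nonneg.2 (hlt ν).le) (hB0 _)
  have hz := (Finset.sum_eq_zero_iff_of_nonneg hnn).1 (le_antisymm hs (Finset.sum_nonneg hnn))
  funext ν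
  have h2 : B (y ν) (y ν) = 0 :=
    (mul_eq_zero.1 (hz ν (Finset.mem_univ _))).resolve_left (sub_pos.2 (hlt ν)).ne'
  have h3 : y ν = 0 := hAB _ (by rw [mem_pairEigenspace.1 (hy ν), h2, mul_zero]) h2
  exact hf ν ((Subtype.ext h3 : f ν (c ν) = 0).trans (map_zero _).symm)

/-- If `A` is smaller than `lam B` on an `n`-dimensional space, and every `y` which is
`B`-orthogonal to the eigenvectors with eigenvalues smaller than `lam` satisfies `lam B y y ≤ A y y`, then there
are at least `n` eigenvalues smaller than `lam`. -/
theorem le_encard_pairLabels {A B : X →ₗ[ℝ] X →ₗ[ℝ] ℝ} {lam : ℝ}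
    (hres : ∀ y, (∀ ν < lam, ∀ e ∈ pairEigenspace A B ν, B y e = 0) → lam * B y y ≤ A y y)
    {ι : Type*} [Fintype ι] (v : (ι → ℝ) →ₗ[ℝ] X)
    (hv : ∀ c, c ≠ 0 → A (v c) (v c) < lam * B (v c) (v c)) :
    (Fintype.card ι : ℕ∞) ≤ (pairLabels A B lam).encard := by
  classical
  by_contra! hlt
  have hfin : (pairLabels A B lam).Finite :=
    Set.encard_lt_top_iff.1 (hlt.trans_le le_top)
  let F := hfin.toFinset
  have hFmem : ∀ p, p ∈ F ↔ p ∈ pairLabels A B lam := fun p => hfin.mem_toFinset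
  have hFcard : F.card < Fintype.card ι := by
    rw [hfin.encard_eq_coe_toFinset_card] at hlt
    exact_mod_cast hlt
  let V : Finset ℝ := F.image Prod.fst
  have hlam : ∀ ν : V, (ν : ℝ) < lam := by
    rintro ⟨ν, hν⟩
    obtain ⟨p, hp, rfl⟩ := Finset.mem_image.1 hν
    exact ((hFmem p).1 hp).1
  -- An infinite-dimensional eigenspace would supply infinitely many labels.
  have hfd : ∀ ν : V, Cardinal.toENat (Module.rank ℝ (pairEigenspace A B (ν : ℝ))) < ⊤ := by
    intro ν
    by_contra! h
    have htop := top_le_iff.1 h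
    have : (Set.range fun k : ℕ => ((ν : ℝ), k)) ⊆ pairLabels A B lam := by
      rintro _ ⟨k, rfl⟩
      exact ⟨hlam ν, by rw [htop]; exact ENat.natCast_lt_top k⟩
    exact Set.infinite_range_of_injective (fun a b h => by simpa using h) (hfin.subset this)
  have hfd' : ∀ ν : V, Module.Finite ℝ (pairEigenspace A B (ν : ℝ)) := by
    intro ν
    have := hfd ν
    rw [← Module.rank_lt_aleph0_iff]
    exact Cardinal.toENat_lt_top.1 this
  have hsum : ∑ ν : V, Module.finrank ℝ (pairEigenspace A B (ν : ℝ)) ≤ F.card := by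
    rw [Finset.sum_coe_sort V fun ν => Module.finrank ℝ (pairEigenspace A B ν)]
    have : (V.sigma fun ν => Finset.range (Module.finrank ℝ (pairEigenspace A B ν))).card
        ≤ F.card := by
      refine Finset.card_le_card_of_injOn (fun p => (p.1, p.2)) (fun p hp => ?_) ?_
      · simp only [Finset.coe_sigma, Set.mem_sigma_iff, Finset.mem_coe, Finset.mem_range] at hp
        refine (hFmem _).2 ⟨hlam ⟨p.1, hp.1⟩, ?_⟩
        have := hfd' ⟨p.1, hp.1⟩
        change ((p.2 : ℕ) : ℕ∞) < Cardinal.toENat (Module.rank ℝ (pairEigenspace A B p.1))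
        rw [← Module.finrank_eq_rank ℝ (pairEigenspace A B p.1), map_natCast]
        exact_mod_cast hp.2
      · rintro ⟨a, b⟩ _ ⟨c, d⟩ _ h
        simpa using h
    simpa using this
  -- The kernel of `R` is the `B`-orthogonal complement of the eigenspaces in `V`. The target has
  -- dimension at most `F.card < Fintype.card ι`, so a nonzero vector of the test space lies in this
  -- kernel.
  let R : X →ₗ[ℝ] (Π ν : V, Module.Dual ℝ (pairEigenspace A B (ν : ℝ))) :=
    LinearMap.pi fun ν => (pairEigenspace A B (ν : ℝ)).subtype.dualMap ∘ₗ B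
  have hker : LinearMap.ker (R ∘ₗ v) ≠ ⊥ := by
    apply LinearMap.ker_ne_bot_of_finrank_lt
    rw [Module.finrank_fintype_fun_eq_card, Module.finrank_pi_fintype]
    simp only [Subspace.dual_finrank_eq]
    omega
  obtain ⟨c, hc, hc0⟩ := (Submodule.ne_bot_iff _).1 hker
  refine absurd (hres (v c) fun ν hν e he => ?_) (not_le.2 (hv c hc0))
  by_cases hV : ν ∈ V
  · have h1 := congrFun (LinearMap.mem_ker.1 hc) ⟨ν, hV⟩
    exact LinearMap.congr_fun h1 ⟨e, he⟩
  · have h0 : Cardinal.toENat (Module.rank ℝ (pairEigenspace A B ν)) = 0 := by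
      by_contra hne
      exact hV (Finset.mem_image.2 ⟨(ν, 0), (hFmem _).2 ⟨hν, by
        simpa using pos_iff_ne_zero.2 hne⟩, rfl⟩)
    rw [Cardinal.toENat_eq_zero, rank_zero_iff] at h0
    have : (⟨e, he⟩ : pairEigenspace A B ν) = 0 := Subsingleton.elim _ _
    rw [show e = 0 from congrArg Subtype.val this, map_zero]

end FormPair

/-! ### Compact symmetric operators -/

section Compact

open Module.End

variable {H : Type*} [NormedAddCommGroup H] [InnerProductSpace ℝ H]

/-- Eigenspaces of a symmetric operator are orthogonal, so the quadratic form is a sum over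
eigencomponents, each weighted by its eigenvalue. -/
theorem inner_le_of_mem_iSup_eigenspace {T : H →L[ℝ] H} (hT' : (T : H →ₗ[ℝ] H).IsSymmetric) {s : ℝ}
    {f : H} (hf : f ∈ ⨆ τ : {τ : ℝ // τ ≤ s}, eigenspace (T : Module.End ℝ H) τ) :
    inner ℝ (T f) f ≤ s * ‖f‖ ^ 2 := by
  classical
  obtain ⟨c, hc, rfl⟩ := (Submodule.mem_iSup_iff_exists_finsupp _ f).1 hf
  have horth : ∀ τ τ' : {τ : ℝ // τ ≤ s}, τ ≠ τ' → inner ℝ (c τ) (c τ') = 0 := fun τ τ' h =>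
    hT'.orthogonalFamily_eigenspaces (fun h' => h (Subtype.ext h')) ⟨_, hc τ⟩ ⟨_, hc τ'⟩
  have hT : ∀ τ, T (c τ) = (τ : ℝ) • c τ := fun τ => mem_eigenspace_iff.1 (hc τ)
  rw [← real_inner_self_eq_norm_sq, Finsupp.sum, map_sum, sum_inner, sum_inner, Finset.mul_sum]
  refine Finset.sum_le_sum fun τ hτ => ?_
  rw [hT, inner_smul_left, inner_sum, Finset.sum_eq_single τ
    (fun τ' _ h => horth τ τ' h.symm) (fun h => absurd hτ h)]
  exact mul_le_mul_of_nonneg_right τ.2 real_inner_self_nonneg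

variable [CompleteSpace H]

/-- Composing `T` with the orthogonal projection onto the span of the Riesz representatives of the
`l i` gives a finite-rank operator within `ε` of `T`, and norm limits of compact operators are
compact. -/
theorem isCompactOperator_of_forall_functionals (T : H →L[ℝ] H)
    (h : ∀ ε > 0, ∃ (n : ℕ) (l : Fin n → H →L[ℝ] ℝ),
      ∀ f, (∀ i, l i f = 0) → ‖T f‖ ≤ ε * ‖f‖) : IsCompactOperator T := by
  have key : ∀ ε > 0, ∃ S : H →L[ℝ] H, IsCompactOperator S ∧ ‖T - S‖ ≤ ε := by
    intro ε hε
    obtain ⟨n, l, hl⟩ := h ε hε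
    let g : Fin n → H := fun i => (InnerProductSpace.toDual ℝ H).symm (l i)
    let G : Submodule ℝ H := Submodule.span ℝ (Set.range g)
    have hG : FiniteDimensional ℝ G := FiniteDimensional.span_of_finite ℝ (Set.finite_range g)
    have hPc : IsCompactOperator (G.subtypeL ∘L G.orthogonalProjectionOnto) := by
      have h1 : IsCompactOperator (id : G → G) :=
        isCompactOperator_id_iff_finiteDimensional (𝕜 := ℝ).2 hG
      exact (h1.clm_comp G.subtypeL).comp_clm G.orthogonalProjectionOnto
    refine ⟨T ∘L (G.subtypeL ∘L G.orthogonalProjectionOnto), hPc.clm_comp T, ?_⟩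
    refine ContinuousLinearMap.opNorm_le_bound _ hε.le fun f => ?_
    let f' := f - (G.orthogonalProjectionOnto f : H)
    have hf' : f' ∈ Gᗮ := G.sub_starProjection_mem_orthogonal f
    have h2 : ‖f'‖ ≤ ‖f‖ := by
      have : f' = Gᗮ.starProjection f := by
        rw [Submodule.starProjection_orthogonal']; rfl
      rw [this]
      exact Submodule.norm_starProjection_apply_le _ _
    have h3 := hl f' fun i => by
      have h4 : inner ℝ (g i) f' = 0 := 
        (Submodule.mem_orthogonal _ _).1 hf' _ (Submodule.subset_span (Set.mem_range_self i))
      rwa [InnerProductSpace.toDual_symm_apply] at h4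
    calc _ = ‖T f'‖ := by simp [f']
      _ ≤ ε * ‖f‖ := h3.trans (mul_le_mul_of_nonneg_left h2 hε.le)
  choose S hS hTS using fun n : ℕ => key (1 / ((n : ℝ) + 1)) (by positivity)
  refine isCompactOperator_of_tendsto (l := Filter.atTop) (F := S) ?_
    (Filter.Eventually.of_forall hS)
  rw [tendsto_iff_norm_sub_tendsto_zero]
  refine squeeze_zero (fun _ => norm_nonneg _) (fun n => ?_) tendsto_one_div_add_atTop_nhds_zero_nat
  rw [norm_sub_rev]
  exact hTS n

/-- If `f` is orthogonal to the eigenspaces of a compact symmetric operator with eigenvalues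
greater than `s`, then `⟪T f, f⟫ ≤ s ‖f‖²`. -/
theorem inner_le_of_orthogonal_eigenspaces {T : H →L[ℝ] H} (hT : IsCompactOperator T)
    (hT' : (T : H →ₗ[ℝ] H).IsSymmetric) {s : ℝ} {f : H}
    (hf : ∀ τ > s, ∀ e ∈ eigenspace (T : Module.End ℝ H) τ, inner ℝ e f = 0) :
    inner ℝ (T f) f ≤ s * ‖f‖ ^ 2 := by
  let K : Submodule ℝ H := ⨆ τ : {τ : ℝ // τ ≤ s}, eigenspace (T : Module.End ℝ H) τ
  have hmem : f ∈ K.topologicalClosure := by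
    let K' := K.topologicalClosure
    have : CompleteSpace K' := K.isClosed_topologicalClosure.completeSpace_coe
    -- The residual `q` turns out to be orthogonal to every eigenspace: by projection for `τ ≤ s`,
    -- by the hypothesis on `f` for `τ > s`. The spectral theorem then gives `q = 0`.
    let q := f - (K'.orthogonalProjectionOnto f : H)
    have hq : q ∈ K'ᗮ := K'.sub_starProjection_mem_orthogonal f
    have hq' : q ∈ (⨆ τ, eigenspace (T : Module.End ℝ H) τ)ᗮ := by
      rw [← Submodule.iInf_orthogonal, Submodule.mem_iInf]
      intro τ
      rw [Submodule.mem_orthogonal]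
      intro e he
      rcases le_or_gt τ s with h | h
      · refine (Submodule.mem_orthogonal _ _).1 hq e (K.le_topologicalClosure ?_)
        exact Submodule.mem_iSup_of_mem (⟨τ, h⟩ : {τ : ℝ // τ ≤ s}) he
      · have he' : e ∈ Kᗮ := by
          rw [← Submodule.iInf_orthogonal, Submodule.mem_iInf]
          intro τ'
          rw [Submodule.mem_orthogonal]
          intro e' he'
          exact hT'.orthogonalFamily_eigenspaces (τ'.2.trans_lt h).ne ⟨_, he'⟩ ⟨_, he⟩
        rw [← Submodule.orthogonal_closure] at he'
        rw [inner_sub_right, hf τ h e he, zero_sub, neg_eq_zero, real_inner_comm]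
        exact (Submodule.mem_orthogonal _ _).1 he' _ (K'.orthogonalProjectionOnto f).2
    rw [ContinuousLinearMap.orthogonalComplement_iSup_eigenspaces_eq_bot hT hT',
      Submodule.mem_bot] at hq'
    rw [sub_eq_zero.1 hq']
    exact (K'.orthogonalProjectionOnto f).2
  have hclosed : IsClosed {f : H | inner ℝ (T f) f ≤ s * ‖f‖ ^ 2} :=
    isClosed_le (by fun_prop) (by fun_prop)
  exact closure_minimal (fun f hf => inner_le_of_mem_iSup_eigenspace hT' hf) hclosed hmem

end Compact

/-- Counting eigenvalues of a pair of forms represented, up to a one-dimensional summand, by a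
compact symmetric operator. -/
theorem le_encard_pairLabels_of_compact {X H : Type*} [AddCommGroup X] [Module ℝ X]
    [NormedAddCommGroup H] [InnerProductSpace ℝ H] [CompleteSpace H]
    {A B : X →ₗ[ℝ] X →ₗ[ℝ] ℝ} (hB : ∀ y z, B y z = B z y)
    {T : H →L[ℝ] H} (hT : IsCompactOperator T) (hT' : (T : H →ₗ[ℝ] H).IsSymmetric)
    (Y : H →ₗ[ℝ] X) (hAY : ∀ f f', A (Y f) (Y f') = inner ℝ f f')
    (hBY : ∀ f f', B (Y f) (Y f') = inner ℝ (T f) f')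
    (e : X) (hAe : ∀ y, A e y = 0) (hAe' : ∀ y, A y e = 0) (hBe : 0 < B e e)
    (hYe : ∀ f, B (Y f) e = 0) (hX : ∀ y, ∃ (c : ℝ) (f : H), y = c • e + Y f)
    {lam : ℝ} (hlam : 0 < lam) {ι : Type*} [Fintype ι] (v : (ι → ℝ) →ₗ[ℝ] X)
    (hv : ∀ c, c ≠ 0 → A (v c) (v c) < lam * B (v c) (v c)) :
    (Fintype.card ι : ℕ∞) ≤ (pairLabels A B lam).encard := by
  refine le_encard_pairLabels (fun y hy => ?_) v hv
  obtain ⟨c, f, rfl⟩ := hX y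
  -- The vector `e` is an eigenvector for the eigenvalue `0 < lam`, which removes the
  -- one-dimensional summand.
  have h0 : c = 0 := by
    have h1 := hy 0 hlam e (mem_pairEigenspace.2 fun η => by rw [hAe, zero_mul])
    rw [map_add, LinearMap.add_apply, hYe, map_smul, LinearMap.smul_apply, add_zero,
      smul_eq_mul] at h1
    exact (mul_eq_zero.1 h1).resolve_right hBe.ne'
  subst h0
  rw [zero_smul, zero_add] at hy ⊢
  have h2 : inner ℝ (T f) f ≤ lam⁻¹ * ‖f‖ ^ 2 := by
    refine inner_le_of_orthogonal_eigenspaces hT hT' fun τ hτ f' hf' => ?_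
    have hτ0 : 0 < τ := (inv_pos.2 hlam).trans hτ
    have hTf' : T f' = τ • f' := Module.End.mem_eigenspace_iff.1 hf'
    -- An eigenvalue `τ` of `T` is the eigenvalue `τ⁻¹` of the pair of forms.
    have h3 : Y f' ∈ pairEigenspace A B τ⁻¹ := by
      refine mem_pairEigenspace.2 fun η => ?_
      obtain ⟨d, f'', rfl⟩ := hX η
      rw [map_add, map_add, map_smul, map_smul, hAe', hYe, hAY, hBY, hTf', inner_smul_left]
      simp [hτ0.ne']
    have h4 := hy τ⁻¹ (inv_lt_of_inv_lt₀ hlam hτ) _ h3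
    rw [hB, hBY, hTf', inner_smul_left] at h4
    exact (mul_eq_zero.1 h4).resolve_left hτ0.ne'
  rw [hAY, hBY, real_inner_self_eq_norm_sq]
  rwa [inv_mul_eq_div, le_div_iff₀' hlam] at h2

/-! ### The Sobolev space on `[0, 1]` and its forms -/

/-- Cauchy–Schwarz against the constant one, obtained by integrating the square of `M * f - G`,
where `M` is the total mass and `G` the integral of `f`. -/
theorem sq_integral_le {α : Type*} [MeasurableSpace α] {ν : Measure α} [IsFiniteMeasure ν]
    {f : α → ℝ} (hf : MemLp f 2 ν) : (∫ x, f x ∂ν) ^ 2 ≤ ν.real univ * ∫ x, f x ^ 2 ∂ν := by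
  have h1 : Integrable f ν := hf.integrable (by norm_num)
  have h2 : Integrable (fun x => f x ^ 2) ν := hf.integrable_sq
  set M := ν.real univ with hM
  set G := ∫ x, f x ∂ν with hG
  rcases eq_or_lt_of_le (measureReal_nonneg : 0 ≤ ν.real univ) with h0 | h0
  · have : ν = 0 := by
      rw [← Measure.measure_univ_eq_zero]
      exact (measureReal_eq_zero_iff).1 h0.symm
    simp [hM, hG, this]
  · have h3 : 0 ≤ ∫ x, (M * f x - G) ^ 2 ∂ν := integral_nonneg fun x => sq_nonneg _
    have h4 : ∫ x, (M * f x - G) ^ 2 ∂ν = M * (M * ∫ x, f x ^ 2 ∂ν - G ^ 2) := by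
      have : ∀ x, (M * f x - G) ^ 2 = M ^ 2 * f x ^ 2 - 2 * M * G * f x + G ^ 2 := fun x => by ring
      simp only [this]
      have e1 : Integrable (fun x => M ^ 2 * f x ^ 2) ν := h2.const_mul _
      have e2 : Integrable (fun x => 2 * M * G * f x) ν := h1.const_mul _
      have e3 : Integrable (fun x => M ^ 2 * f x ^ 2 - 2 * M * G * f x) ν := e1.sub e2
      rw [integral_add e3 (integrable_const _), integral_sub e1 e2,
        integral_const_mul, integral_const_mul,
        integral_const, ← hM, ← hG, smul_eq_mul]
      ring
    rw [h4] at h3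
    have := nonneg_of_mul_nonneg_right h3 h0
    linarith

theorem AbsolutelyContinuousOnInterval.congr {y z : ℝ → ℝ} {a b : ℝ}
    (hy : AbsolutelyContinuousOnInterval y a b) (h : EqOn y z (uIcc a b)) :
    AbsolutelyContinuousOnInterval z a b := by
  rw [absolutelyContinuousOnInterval_iff] at hy ⊢
  intro ε hε
  obtain ⟨δ, hδ, H⟩ := hy ε hε
  refine ⟨δ, hδ, fun E hE hlt => ?_⟩
  refine lt_of_eq_of_lt (Finset.sum_congr rfl fun i hi => ?_) (H E hE hlt)
  rw [h (hE.1 i hi).1, h (hE.1 i hi).2]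

theorem deriv_eq_of_eqOn_Icc {y z : ℝ → ℝ} (h : EqOn y z (Icc 0 1)) {x : ℝ}
    (hx : x ∈ Ioo (0 : ℝ) 1) : deriv y x = deriv z x := by
  refine Filter.EventuallyEq.deriv_eq ?_
  filter_upwards [Icc_mem_nhds hx.1 hx.2] with t ht using h ht

theorem deriv_ae_eq_of_eqOn_Icc {y z : ℝ → ℝ} (h : EqOn y z (Icc 0 1)) :
    deriv y =ᵐ[volume.restrict (Icc (0 : ℝ) 1)] deriv z := by
  rw [← restrict_Ioo_eq_restrict_Icc]
  filter_upwards [ae_restrict_mem measurableSet_Ioo] with x hx using deriv_eq_of_eqOn_Icc h hx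

theorem MemW12.congr {y z : ℝ → ℝ} (hy : MemW12 y) (h : EqOn y z (Icc 0 1)) : MemW12 z :=
  ⟨hy.1.congr (by rwa [uIcc_of_le zero_le_one]),
    (memLp_congr_ae (deriv_ae_eq_of_eqOn_Icc h)).1 hy.2⟩

theorem MemW12.of_lipschitz {y : ℝ → ℝ} {K : NNReal} (hy : LipschitzWith K y) : MemW12 y := by
  refine ⟨hy.lipschitzOnWith.absolutelyContinuousOnInterval, ?_⟩
  refine MemLp.of_bound (measurable_deriv y).aestronglyMeasurable K ?_
  exact Filter.Eventually.of_forall fun x => norm_deriv_le_of_lipschitz hy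

/-- The set `U` localises the energy: with disjoint cells as `U`, the estimates can be summed over
cells. -/
theorem MemW12.sq_sub_le {y : ℝ → ℝ} (hy : MemW12 y) {x z : ℝ} (hx : x ∈ Icc (0 : ℝ) 1)
    (hz : z ∈ Icc (0 : ℝ) 1) {U : Set ℝ} (hU1 : U ⊆ Icc 0 1)
    (hxz : uIoo z x ⊆ U) : (y x - y z) ^ 2 ≤ |x - z| * ∫ t in U, deriv y t ^ 2 := by
  have hsub : uIcc z x ⊆ Icc 0 1 := by
    rw [← uIcc_of_le (zero_le_one' ℝ)] at hx hz ⊢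
    exact uIcc_subset_uIcc hz hx
  have hac : AbsolutelyContinuousOnInterval y z x :=
    hy.1.mono (by rwa [uIcc_of_le (zero_le_one' ℝ)])
  have hsub' : uIoc z x ⊆ Icc 0 1 := uIoc_subset_uIcc.trans hsub
  have h2 : MemLp (deriv y) 2 (volume.restrict (uIoc z x)) :=
    hy.2.mono_measure (Measure.restrict_mono hsub' le_rfl)
  rw [← hac.integral_deriv_eq_sub, ← sq_abs, intervalIntegral.abs_intervalIntegral_eq, sq_abs]
  have : IsFiniteMeasure (volume.restrict (uIoc z x)) :=
    ⟨by rw [Measure.restrict_apply_univ, uIoc, Real.volume_Ioc]; exact ENNReal.ofReal_lt_top⟩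
  refine (sq_integral_le h2).trans ?_
  have h3 : (volume.restrict (uIoc z x)).real univ = |x - z| := by
    rw [measureReal_restrict_apply_univ, uIoc, Real.volume_real_Ioc_of_le min_le_max,
      max_sub_min_eq_abs]
  rw [h3]
  refine mul_le_mul_of_nonneg_left ?_ (abs_nonneg _)
  have h4 : uIoc z x =ᵐ[volume] uIoo z x := Ioo_ae_eq_Ioc.symm
  rw [setIntegral_congr_set h4]
  exact setIntegral_mono_set ((hy.2.mono_measure (Measure.restrict_mono hU1 le_rfl)).integrable_sq)
    (Filter.Eventually.of_forall fun t => sq_nonneg _) hxz.eventuallyLE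

/-- The functions on `[0, 1]` which belong to `W_2^1[0, 1]`. -/
def sobolevSpace : Submodule ℝ (Icc (0 : ℝ) 1 → ℝ) where
  carrier := {f | MemW12 (IccExtend zero_le_one f)}
  zero_mem' := (IsGeneralizedSolution.zero 0 0).1
  add_mem' := fun hf hg => (MemW12.add hf hg).1
  smul_mem' := fun c _ hf => (MemW12.smul c hf).1

namespace sobolevSpace

/-- The extension of a Sobolev function on `[0, 1]` by constants. -/
noncomputable def ext (y : sobolevSpace) : ℝ → ℝ := IccExtend zero_le_one y.1

theorem memW12 (y : sobolevSpace) : MemW12 (ext y) := y.2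

theorem ext_add (y z : sobolevSpace) : ext (y + z) = ext y + ext z := rfl

theorem ext_smul (c : ℝ) (y : sobolevSpace) : ext (c • y) = c • ext y := rfl

theorem ext_apply (y : sobolevSpace) {x : ℝ} (hx : x ∈ Icc (0 : ℝ) 1) : ext y x = y.1 ⟨x, hx⟩ :=
  IccExtend_of_mem _ _ hx

theorem continuousOn_ext (y : sobolevSpace) : ContinuousOn (ext y) (Icc 0 1) := by
  have := (memW12 y).1.continuousOn
  rwa [uIcc_of_le zero_le_one] at this

theorem continuous_ext (y : sobolevSpace) : Continuous (ext y) := by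
  refine Continuous.Icc_extend' ?_
  have := (continuousOn_ext y).domRestrict
  convert this using 1
  funext x
  exact (ext_apply y x.2).symm

/-- The restriction of a `W_2^1` function to `[0, 1]`. -/
def ofMemW12 (y : ℝ → ℝ) (hy : MemW12 y) : sobolevSpace :=
  ⟨fun x => y x, hy.congr fun _ hx => (IccExtend_of_mem zero_le_one (fun t => y t) hx).symm⟩

theorem ext_ofMemW12 {y : ℝ → ℝ} (hy : MemW12 y) : EqOn (ext (ofMemW12 y hy)) y (Icc 0 1) :=
  fun _ hx => ext_apply _ hx

theorem integrable_deriv_mul_deriv (y z : sobolevSpace) :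
    IntegrableOn (fun x => deriv (ext y) x * deriv (ext z) x) (Icc 0 1) :=
  (memW12 y).2.integrable_mul (memW12 z).2

/-- The evaluation at a point. -/
noncomputable def eval (x : ℝ) : sobolevSpace →ₗ[ℝ] ℝ where
  toFun y := ext y x
  map_add' _ _ := rfl
  map_smul' _ _ := rfl

end sobolevSpace

open sobolevSpace

/-- The form `∫ y' η'` on the Sobolev space. -/
noncomputable def energyForm : sobolevSpace →ₗ[ℝ] sobolevSpace →ₗ[ℝ] ℝ :=
  LinearMap.mk₂ ℝ (fun y z => ∫ x in Icc (0 : ℝ) 1, deriv (ext y) x * deriv (ext z) x)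
    (fun y z w => by
      rw [← integral_add (integrable_deriv_mul_deriv y w) (integrable_deriv_mul_deriv z w)]
      refine integral_congr_ae ?_
      filter_upwards [((memW12 y).add (memW12 z)).2] with x hx
      rw [ext_add, hx, add_mul])
    (fun c y z => by
      rw [ext_smul, ((memW12 y).smul c).2, smul_eq_mul, ← integral_const_mul]
      simp only [mul_assoc])
    (fun y z w => by
      rw [← integral_add (integrable_deriv_mul_deriv y z) (integrable_deriv_mul_deriv y w)]
      refine integral_congr_ae ?_
      filter_upwards [((memW12 z).add (memW12 w)).2] with x hx
      rw [ext_add, hx, mul_add])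
    (fun c y z => by
      rw [ext_smul, ((memW12 z).smul c).2, smul_eq_mul, ← integral_const_mul]
      simp only [mul_left_comm])

/-- The form `∫ y η dμ` on the Sobolev space. -/
noncomputable def massForm (μ : Measure ℝ) [IsFiniteMeasure μ] :
    sobolevSpace →ₗ[ℝ] sobolevSpace →ₗ[ℝ] ℝ :=
  LinearMap.mk₂ ℝ (fun y z => ∫ x in Icc (0 : ℝ) 1, ext y x * ext z x ∂μ)
    (fun y z w => by
      rw [← integral_add ((memW12 y).integrable_mul μ (memW12 w))
        ((memW12 z).integrable_mul μ (memW12 w))]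
      simp only [ext_add, Pi.add_apply, add_mul])
    (fun c y z => by
      rw [smul_eq_mul, ← integral_const_mul]
      simp only [ext_smul, Pi.smul_apply, smul_eq_mul, mul_assoc])
    (fun y z w => by
      rw [← integral_add ((memW12 y).integrable_mul μ (memW12 z))
        ((memW12 y).integrable_mul μ (memW12 w))]
      simp only [ext_add, Pi.add_apply, mul_add])
    (fun c y z => by
      rw [smul_eq_mul, ← integral_const_mul]
      simp only [ext_smul, Pi.smul_apply, smul_eq_mul, mul_left_comm])

theorem energyForm_apply (y z : sobolevSpace) :
    energyForm y z = ∫ x in Icc (0 : ℝ) 1, deriv (ext y) x * deriv (ext z) x := rfl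

theorem energyForm_self (y : sobolevSpace) :
    energyForm y y = ∫ x in Icc (0 : ℝ) 1, deriv (ext y) x ^ 2 := by
  simp only [energyForm_apply, sq]

theorem massForm_apply (μ : Measure ℝ) [IsFiniteMeasure μ] (y z : sobolevSpace) :
    massForm μ y z = ∫ x in Icc (0 : ℝ) 1, ext y x * ext z x ∂μ := rfl

theorem massForm_self (μ : Measure ℝ) [IsFiniteMeasure μ] (y : sobolevSpace) :
    massForm μ y y = ∫ x in Icc (0 : ℝ) 1, ext y x ^ 2 ∂μ := by
  simp only [massForm_apply, sq]

theorem energyForm_comm (y z : sobolevSpace) : energyForm y z = energyForm z y := by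
  simp only [energyForm_apply, mul_comm]

theorem massForm_comm (μ : Measure ℝ) [IsFiniteMeasure μ] (y z : sobolevSpace) :
    massForm μ y z = massForm μ z y := by
  simp only [massForm_apply, mul_comm]

theorem massForm_nonneg (μ : Measure ℝ) [IsFiniteMeasure μ] (y : sobolevSpace) :
    0 ≤ massForm μ y y := by
  rw [massForm_self]
  exact integral_nonneg fun x => sq_nonneg _

theorem massForm_sq_le (μ : Measure ℝ) [IsFiniteMeasure μ] (y z : sobolevSpace) :
    massForm μ y z ^ 2 ≤ massForm μ y y * massForm μ z z :=
  LinearMap.BilinForm.apply_sq_le_of_symm (massForm μ) (massForm_nonneg μ)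
    ⟨fun y z => massForm_comm μ y z⟩ y z

/-- The constant function one. -/
def sobolevOne : sobolevSpace :=
  ofMemW12 (fun _ => 1) (MemW12.of_lipschitz (LipschitzWith.const 1))

theorem ext_sobolevOne : ext sobolevOne = fun _ => 1 := rfl

theorem energyForm_one (y : sobolevSpace) : energyForm sobolevOne y = 0 := by
  simp [energyForm_apply, ext_sobolevOne]

theorem massForm_one (μ : Measure ℝ) [IsFiniteMeasure μ] :
    massForm μ sobolevOne sobolevOne = μ.real (Icc 0 1) := by
  simp [massForm_apply, ext_sobolevOne]

theorem massForm_le_of_bound (μ : Measure ℝ) [IsFiniteMeasure μ] {y : sobolevSpace} {C : ℝ}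
    (hC : ∀ x ∈ Icc (0 : ℝ) 1, ext y x ^ 2 ≤ C) : massForm μ y y ≤ μ.real (Icc 0 1) * C := by
  rw [massForm_self]
  calc _ ≤ ∫ _ in Icc (0 : ℝ) 1, C ∂μ := by
        refine setIntegral_mono_on ?_ (integrable_const _) measurableSet_Icc hC
        simpa only [sq] using! (memW12 y).integrable_mul μ (memW12 y)
    _ = _ := by simp

theorem mem_eigenspaceNeumann_iff (μ : Measure ℝ) [IsFiniteMeasure μ] {ν : ℝ} {y : sobolevSpace} :
    y ∈ pairEigenspace energyForm (massForm μ) ν ↔ y.1 ∈ eigenspaceNeumann μ ν := by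
  rw [mem_pairEigenspace]
  constructor
  · refine fun h => ⟨y.2, fun η hη => ?_⟩
    have h1 := h (ofMemW12 η hη)
    rw [energyForm_apply, massForm_apply] at h1
    rw [intervalIntegral.integral_of_le zero_le_one, ← integral_Icc_eq_integral_Ioc]
    have e1 : ∫ x in Icc (0 : ℝ) 1, deriv (ext y) x * deriv η x =
        ∫ x in Icc (0 : ℝ) 1, deriv (ext y) x * deriv (ext (ofMemW12 η hη)) x := by
      refine integral_congr_ae ?_
      filter_upwards [deriv_ae_eq_of_eqOn_Icc (ext_ofMemW12 hη)] with x hx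
      rw [hx]
    have e2 : ∫ x in Icc (0 : ℝ) 1, ext y x * η x ∂μ =
        ∫ x in Icc (0 : ℝ) 1, ext y x * ext (ofMemW12 η hη) x ∂μ :=
      setIntegral_congr_fun measurableSet_Icc fun x hx => by simp only [ext_ofMemW12 hη hx]
    rw [← e1, ← e2] at h1
    exact h1
  · intro h η
    have h1 := h.2 (ext η) (memW12 η)
    rwa [intervalIntegral.integral_of_le zero_le_one, ← integral_Icc_eq_integral_Ioc] at h1

theorem eigenvalueMultiplicity_eq (μ : Measure ℝ) [IsFiniteMeasure μ] (ν : ℝ) :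
    eigenvalueMultiplicity μ ν =
      Cardinal.toENat (Module.rank ℝ (pairEigenspace energyForm (massForm μ) ν)) := by
  have h : (pairEigenspace energyForm (massForm μ) ν).map sobolevSpace.subtype =
      eigenspaceNeumann μ ν := by
    ext f
    constructor
    · rintro ⟨y, hy, rfl⟩
      exact (mem_eigenspaceNeumann_iff μ).1 hy
    · exact fun hf => ⟨⟨f, hf.1⟩, (mem_eigenspaceNeumann_iff μ).2 hf, rfl⟩
  rw [eigenvalueMultiplicity, ← h]
  congr 1
  exact (Submodule.equivMapOfInjective _ sobolevSpace.injective_subtype _).rank_eq.symm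

theorem eigenvalueCount_eq (μ : Measure ℝ) [IsFiniteMeasure μ] (lam : ℝ) :
    eigenvalueCount μ lam = (pairLabels energyForm (massForm μ) lam).encard := by
  simp only [eigenvalueCount, pairLabels, eigenvalueMultiplicity_eq]

theorem sq_ext_sub_le (y : sobolevSpace) {x z : ℝ} (hx : x ∈ Icc (0 : ℝ) 1)
    (hz : z ∈ Icc (0 : ℝ) 1) : (ext y x - ext y z) ^ 2 ≤ |x - z| * energyForm y y := by
  rw [energyForm_self]
  refine (memW12 y).sq_sub_le hx hz Subset.rfl fun t ht => ?_
  have h : t ∈ uIcc z x := Ioo_subset_Icc_self ht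
  rw [← uIcc_of_le (zero_le_one' ℝ)] at hx hz ⊢
  exact uIcc_subset_uIcc hz hx h

/-- Zero energy forces a constant, and a constant with zero mass vanishes because `μ` charges `[0,
1]`. -/
theorem eq_zero_of_forms_eq_zero {μ : Measure ℝ} [IsFiniteMeasure μ] (hμ : 0 < μ (Icc 0 1))
    {y : sobolevSpace} (h1 : energyForm y y = 0) (h2 : massForm μ y y = 0) : y = 0 := by
  have h0 : (0 : ℝ) ∈ Icc (0 : ℝ) 1 := ⟨le_rfl, zero_le_one⟩
  have hc : ∀ x ∈ Icc (0 : ℝ) 1, ext y x = ext y 0 := fun x hx => by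
    have := sq_ext_sub_le y hx h0
    rw [h1, mul_zero] at this
    exact sub_eq_zero.1 (pow_eq_zero_iff two_ne_zero |>.1 (le_antisymm this (sq_nonneg _)))
  have h3 : massForm μ y y = μ.real (Icc 0 1) * ext y 0 ^ 2 := by
    rw [massForm_self, setIntegral_congr_fun (g := fun _ => ext y 0 ^ 2) measurableSet_Icc
      fun x hx => by simp only [hc x hx]]
    simp
  rw [h2] at h3
  have h4 : μ.real (Icc 0 1) ≠ 0 := (ENNReal.toReal_pos hμ.ne' (measure_ne_top _ _)).ne'
  have h5 : ext y 0 = 0 := by simpa [h4] using h3.symm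
  ext x
  rw [← ext_apply y x.2, hc x x.2, h5]; rfl

/-! ### The compact operator of the Neumann problem -/

open sobolevSpace

/-- The square integrable functions on `[0, 1]`. -/
abbrev unitL2 : Type := Lp ℝ 2 (volume.restrict (Icc (0 : ℝ) 1))

namespace unitL2

theorem intervalIntegrable (f : unitL2) : IntervalIntegrable f volume 0 1 := by
  rw [intervalIntegrable_iff_integrableOn_Icc_of_le zero_le_one]
  exact (Lp.memLp f).integrable (by norm_num)

theorem intervalIntegrable_of_mem (f : unitL2) {x : ℝ} (hx : x ∈ Icc (0 : ℝ) 1) :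
    IntervalIntegrable f volume 0 x := by
  refine (intervalIntegrable f).mono_set ?_
  rw [uIcc_of_le hx.1, uIcc_of_le zero_le_one]
  exact Icc_subset_Icc_right hx.2

theorem deriv_integral (f : unitL2) :
    deriv (fun x => ∫ t in (0 : ℝ)..x, f t) =ᵐ[volume.restrict (Icc (0 : ℝ) 1)] f := by
  rw [Filter.EventuallyEq, ae_restrict_iff' measurableSet_Icc]
  filter_upwards [(intervalIntegrable f).ae_hasDerivAt_integral] with x hx hx1
  rw [uIcc_of_le zero_le_one] at hx
  exact (hx hx1 0 ⟨le_rfl, zero_le_one⟩).deriv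

theorem memW12_integral (f : unitL2) : MemW12 (fun x => ∫ t in (0 : ℝ)..x, f t) :=
  ⟨(intervalIntegrable f).absolutelyContinuousOnInterval_intervalIntegral left_mem_uIcc,
    (memLp_congr_ae (deriv_integral f)).2 (Lp.memLp f)⟩

theorem integral_congr_of_ae {f g : ℝ → ℝ} (h : f =ᵐ[volume.restrict (Icc (0 : ℝ) 1)] g) {x : ℝ}
    (hx : x ∈ Icc (0 : ℝ) 1) : ∫ t in (0 : ℝ)..x, f t = ∫ t in (0 : ℝ)..x, g t := by
  refine intervalIntegral.integral_congr_ae ?_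
  rw [Filter.EventuallyEq, ae_restrict_iff' measurableSet_Icc] at h
  filter_upwards [h] with t ht htx
  rw [uIoc_of_le hx.1] at htx
  exact ht ⟨htx.1.le, htx.2.trans hx.2⟩

/-- The primitive vanishing at zero. -/
noncomputable def primitive : unitL2 →ₗ[ℝ] sobolevSpace where
  toFun f := ofMemW12 _ (memW12_integral f)
  map_add' f g := by
    ext x
    change ∫ t in (0 : ℝ)..x, (f + g : unitL2) t = _
    rw [integral_congr_of_ae (Lp.coeFn_add f g) x.2]
    exact intervalIntegral.integral_add (intervalIntegrable_of_mem f x.2)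
      (intervalIntegrable_of_mem g x.2)
  map_smul' c f := by
    ext x
    change ∫ t in (0 : ℝ)..x, (c • f : unitL2) t = _
    rw [integral_congr_of_ae (Lp.coeFn_smul c f) x.2]
    exact intervalIntegral.integral_smul c _

theorem ext_primitive (f : unitL2) :
    EqOn (ext (primitive f)) (fun x => ∫ t in (0 : ℝ)..x, f t) (Icc 0 1) :=
  ext_ofMemW12 (memW12_integral f)

theorem energyForm_primitive (f g : unitL2) :
    energyForm (primitive f) (primitive g) = inner ℝ f g := by
  rw [energyForm_apply, L2.inner_def]
  refine integral_congr_ae ?_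
  filter_upwards [deriv_ae_eq_of_eqOn_Icc (ext_primitive f), deriv_integral f,
    deriv_ae_eq_of_eqOn_Icc (ext_primitive g), deriv_integral g] with x h1 h2 h3 h4
  rw [h1, h2, h3, h4, mul_comm]; rfl

theorem sq_ext_primitive_le (f : unitL2) {x : ℝ} (hx : x ∈ Icc (0 : ℝ) 1) :
    ext (primitive f) x ^ 2 ≤ ‖f‖ ^ 2 := by
  have h0 : (0 : ℝ) ∈ Icc (0 : ℝ) 1 := ⟨le_rfl, zero_le_one⟩
  have h := sq_ext_sub_le (primitive f) hx h0
  rw [ext_primitive f h0, energyForm_primitive, real_inner_self_eq_norm_sq] at h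
  simp only [intervalIntegral.integral_same, sub_zero] at h
  refine h.trans (mul_le_of_le_one_left (sq_nonneg _) ?_)
  rw [abs_of_nonneg hx.1]
  exact hx.2

theorem exists_eq_add_primitive (y : sobolevSpace) :
    ∃ (c : ℝ) (f : unitL2), y = c • sobolevOne + primitive f := by
  refine ⟨ext y 0, (memW12 y).2.toLp _, ?_⟩
  ext x
  have h1 : ∫ t in (0 : ℝ)..x, deriv (ext y) t = ext y x - ext y 0 := by
    refine AbsolutelyContinuousOnInterval.integral_deriv_eq_sub ((memW12 y).1.mono ?_)
    rw [uIcc_of_le x.2.1, uIcc_of_le zero_le_one]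
    exact Icc_subset_Icc_right x.2.2
  change y.1 x = ext y 0 * 1 + ∫ t in (0 : ℝ)..x, ((memW12 y).2.toLp _ : unitL2) t
  rw [integral_congr_of_ae (memW12 y).2.coeFn_toLp x.2, h1, ext_apply y x.2]
  ring

section

variable (μ : Measure ℝ) [IsFiniteMeasure μ]

/-- The mean of the primitive. -/
noncomputable def meanPrimitive : unitL2 →ₗ[ℝ] ℝ :=
  (μ.real (Icc 0 1))⁻¹ • (massForm μ).flip sobolevOne ∘ₗ primitive

/-- The primitive of mean zero. -/
noncomputable def centeredPrimitive : unitL2 →ₗ[ℝ] sobolevSpace :=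
  primitive - (meanPrimitive μ).smulRight sobolevOne

variable {μ}

theorem centeredPrimitive_apply (f : unitL2) :
    centeredPrimitive μ f = primitive f - meanPrimitive μ f • sobolevOne := rfl

theorem massForm_centeredPrimitive_one (hμ : 0 < μ (Icc 0 1)) (f : unitL2) :
    massForm μ (centeredPrimitive μ f) sobolevOne = 0 := by
  have h : μ.real (Icc 0 1) ≠ 0 := (ENNReal.toReal_pos hμ.ne' (measure_ne_top _ _)).ne'
  rw [centeredPrimitive_apply, map_sub, LinearMap.sub_apply, map_smul, LinearMap.smul_apply,
    massForm_one, smul_eq_mul]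
  simp [meanPrimitive, h, mul_comm]

theorem energyForm_centeredPrimitive (f g : unitL2) :
    energyForm (centeredPrimitive μ f) (centeredPrimitive μ g) = inner ℝ f g := by
  simp [centeredPrimitive_apply, energyForm_one, energyForm_comm _ sobolevOne,
    energyForm_primitive]

theorem exists_eq_add_centeredPrimitive (y : sobolevSpace) :
    ∃ (c : ℝ) (f : unitL2), y = c • sobolevOne + centeredPrimitive μ f := by
  obtain ⟨c, f, rfl⟩ := exists_eq_add_primitive y
  refine ⟨c + meanPrimitive μ f, f, ?_⟩
  rw [centeredPrimitive_apply, add_smul]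
  abel

/-- Centring removes the `μ`-orthogonal component along constants, so by Pythagoras it does not
increase the mass. -/
theorem massForm_centeredPrimitive_le (hμ : 0 < μ (Icc 0 1)) (f : unitL2) :
    massForm μ (centeredPrimitive μ f) (centeredPrimitive μ f) ≤ μ.real (Icc 0 1) * ‖f‖ ^ 2 := by
  refine le_trans ?_ (massForm_le_of_bound μ fun x hx => sq_ext_primitive_le f hx)
  have h1 : primitive f = centeredPrimitive μ f + meanPrimitive μ f • sobolevOne := by
    rw [centeredPrimitive_apply]; abel
  have h2 := massForm_nonneg μ (meanPrimitive μ f • sobolevOne)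
  rw [h1]
  simp only [map_add, LinearMap.add_apply, map_smul, LinearMap.smul_apply] at h2 ⊢
  rw [massForm_comm μ sobolevOne (centeredPrimitive μ f), massForm_centeredPrimitive_one hμ]
  simpa using h2

theorem abs_meanPrimitive_le (hμ : 0 < μ (Icc 0 1)) (f : unitL2) :
    |meanPrimitive μ f| ≤ ‖f‖ := by
  have h : 0 < μ.real (Icc 0 1) := ENNReal.toReal_pos hμ.ne' (measure_ne_top _ _)
  have h1 := massForm_sq_le μ (primitive f) sobolevOne
  have h2 := massForm_le_of_bound μ fun x hx => sq_ext_primitive_le f hx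
  rw [massForm_one] at h1
  change |(μ.real (Icc 0 1))⁻¹ * massForm μ (primitive f) sobolevOne| ≤ _
  refine abs_le_of_sq_le_sq ?_ (norm_nonneg _)
  rw [mul_pow, inv_pow, inv_mul_le_iff₀ (by positivity)]
  nlinarith [mul_le_mul_of_nonneg_right h2 h.le]

theorem abs_ext_centeredPrimitive_le (hμ : 0 < μ (Icc 0 1)) (f : unitL2) {x : ℝ}
    (hx : x ∈ Icc (0 : ℝ) 1) : |ext (centeredPrimitive μ f) x| ≤ 2 * ‖f‖ := by
  have h1 : ext (centeredPrimitive μ f) x = ext (primitive f) x - meanPrimitive μ f := by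
    rw [ext_apply _ hx, ext_apply _ hx, centeredPrimitive_apply]
    change _ - meanPrimitive μ f * 1 = _
    rw [mul_one]
  have h2 := abs_le_of_sq_le_sq (sq_ext_primitive_le f hx) (norm_nonneg _)
  rw [h1, two_mul]
  exact (abs_sub _ _).trans (add_le_add h2 (abs_meanPrimitive_le hμ f))

theorem abs_massForm_centeredPrimitive_le (hμ : 0 < μ (Icc 0 1)) (f g : unitL2) :
    |massForm μ (centeredPrimitive μ f) (centeredPrimitive μ g)|
      ≤ μ.real (Icc 0 1) * ‖f‖ * ‖g‖ := by
  refine abs_le_of_sq_le_sq ((massForm_sq_le μ _ _).trans ?_) (by positivity)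
  calc _ ≤ (μ.real (Icc 0 1) * ‖f‖ ^ 2) * (μ.real (Icc 0 1) * ‖g‖ ^ 2) :=
        mul_le_mul (massForm_centeredPrimitive_le hμ f) (massForm_centeredPrimitive_le hμ g)
          (massForm_nonneg μ _) (by positivity)
    _ = _ := by ring

/-- The operator representing the form `∫ y η dμ` on functions of mean zero. -/
noncomputable def neumannOperator (hμ : 0 < μ (Icc 0 1)) : unitL2 →L[ℝ] unitL2 :=
  InnerProductSpace.continuousLinearMapOfBilin (𝕜 := ℝ)
    (LinearMap.mkContinuous₂ ((massForm μ).compl₁₂ (centeredPrimitive μ) (centeredPrimitive μ))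
      (μ.real (Icc 0 1)) fun f g => abs_massForm_centeredPrimitive_le hμ f g)

theorem inner_neumannOperator (hμ : 0 < μ (Icc 0 1)) (f g : unitL2) :
    inner ℝ (neumannOperator hμ f) g =
      massForm μ (centeredPrimitive μ f) (centeredPrimitive μ g) := by
  rw [neumannOperator, InnerProductSpace.continuousLinearMapOfBilin_apply]
  rfl

theorem isSymmetric_neumannOperator (hμ : 0 < μ (Icc 0 1)) :
    (neumannOperator hμ : unitL2 →ₗ[ℝ] unitL2).IsSymmetric := fun f g => by
  change inner ℝ (neumannOperator hμ f) g = inner ℝ f (neumannOperator hμ g)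
  rw [inner_neumannOperator, real_inner_comm, inner_neumannOperator, massForm_comm]

theorem isCompactOperator_neumannOperator (hμ : 0 < μ (Icc 0 1)) :
    IsCompactOperator (neumannOperator hμ) := by
  have hM : 0 < μ.real (Icc 0 1) := ENNReal.toReal_pos hμ.ne' (measure_ne_top _ _)
  refine isCompactOperator_of_forall_functionals _ fun ε hε => ?_
  -- With `M` the mass of `[0, 1]`, this gives `M ^ 2 / n ≤ ε ^ 2`. If the centred primitive
  -- vanishes at all points `i / n`, its square is at most `‖f‖ ^ 2 / n`.
  obtain ⟨n, hn⟩ := exists_nat_gt ((μ.real (Icc 0 1) / ε) ^ 2)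
  have hn0 : (0 : ℝ) < n := (sq_nonneg _).trans_lt hn
  have hp : ∀ i : Fin (n + 1), (i / n : ℝ) ∈ Icc (0 : ℝ) 1 := fun i =>
    ⟨by positivity, div_le_one_of_le₀ (by exact_mod_cast Nat.lt_succ_iff.1 i.2) hn0.le⟩
  refine ⟨n + 1, fun i => LinearMap.mkContinuous (eval (i / n) ∘ₗ centeredPrimitive μ) 2
    fun f => abs_ext_centeredPrimitive_le hμ f (hp i), fun f hf => ?_⟩
  have hf' : ∀ i : Fin (n + 1), ext (centeredPrimitive μ f) (i / n) = 0 := hf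
  have h1 : ∀ x ∈ Icc (0 : ℝ) 1, ext (centeredPrimitive μ f) x ^ 2 ≤ 1 / n * ‖f‖ ^ 2 := by
    intro x hx
    have hx0 : 0 ≤ x * n := mul_nonneg hx.1 hn0.le
    have hi : ⌊x * n⌋₊ < n + 1 := by
      rw [Nat.lt_succ_iff]
      exact Nat.floor_le_of_le (mul_le_of_le_one_left hn0.le hx.2)
    have h2 := sq_ext_sub_le (centeredPrimitive μ f) hx (hp ⟨_, hi⟩)
    rw [hf', sub_zero, energyForm_centeredPrimitive, real_inner_self_eq_norm_sq] at h2
    refine h2.trans (mul_le_mul_of_nonneg_right ?_ (sq_nonneg _))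
    have h3 : x - (⌊x * n⌋₊ : ℝ) / n = (x * n - ⌊x * n⌋₊) / n := by field_simp
    change |x - (⌊x * n⌋₊ : ℝ) / n| ≤ _
    rw [h3, abs_of_nonneg (div_nonneg (sub_nonneg.2 (Nat.floor_le hx0)) hn0.le)]
    gcongr
    linarith [Nat.lt_floor_add_one (x * n)]
  have h2 := massForm_le_of_bound μ h1
  set g := neumannOperator hμ f
  -- Testing against `g`, the image of `f`, and applying Cauchy–Schwarz for the mass form bounds
  -- `‖g‖ ^ 4` by a multiple of `‖g‖ ^ 2`.
  have h3 : ‖g‖ ^ 2 = massForm μ (centeredPrimitive μ f) (centeredPrimitive μ g) := by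
    rw [← inner_neumannOperator hμ, real_inner_self_eq_norm_sq]
  have h4 := massForm_sq_le μ (centeredPrimitive μ f) (centeredPrimitive μ g)
  have h5 := massForm_centeredPrimitive_le hμ g
  rcases eq_or_lt_of_le (norm_nonneg g) with h0 | h0
  · rw [← h0]; positivity
  refine abs_le_of_sq_le_sq' ?_ (by positivity) |>.2
  have h6 : (‖g‖ ^ 2) ^ 2 ≤
      (μ.real (Icc 0 1) * (1 / n * ‖f‖ ^ 2)) * (μ.real (Icc 0 1) * ‖g‖ ^ 2) := by
    rw [h3]
    exact h4.trans (mul_le_mul h2 (h3 ▸ h5) (massForm_nonneg μ _) (by positivity))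
  have h7 : ‖g‖ ^ 2 ≤ μ.real (Icc 0 1) ^ 2 / n * ‖f‖ ^ 2 := by
    refine le_of_mul_le_mul_right ?_ (pow_pos h0 2)
    calc _ = (‖g‖ ^ 2) ^ 2 := by ring
      _ ≤ _ := h6
      _ = _ := by ring
  rw [mul_pow]
  refine h7.trans (mul_le_mul_of_nonneg_right ?_ (sq_nonneg _))
  rw [div_pow, div_lt_iff₀ (by positivity)] at hn
  rw [div_le_iff₀ hn0]
  linarith

end

end unitL2

/-- If the energy is smaller than `lam` times the mass on an `n`-dimensional space of functions,
there are at least `n` eigenvalues smaller than `lam`. -/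
theorem le_eigenvalueCount {μ : Measure ℝ} [IsFiniteMeasure μ] (hμ : 0 < μ (Icc 0 1))
    {lam : ℝ} (hlam : 0 < lam) {ι : Type*} [Fintype ι] (v : (ι → ℝ) →ₗ[ℝ] sobolevSpace)
    (hv : ∀ c, c ≠ 0 → energyForm (v c) (v c) < lam * massForm μ (v c) (v c)) :
    (Fintype.card ι : ℕ∞) ≤ eigenvalueCount μ lam := by
  rw [eigenvalueCount_eq]
  refine le_encard_pairLabels_of_compact (massForm_comm μ)
    (unitL2.isCompactOperator_neumannOperator hμ) (unitL2.isSymmetric_neumannOperator hμ)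
    (unitL2.centeredPrimitive μ) unitL2.energyForm_centeredPrimitive
    (fun f g => (unitL2.inner_neumannOperator hμ f g).symm) sobolevOne energyForm_one
    (fun y => by rw [energyForm_comm, energyForm_one]) ?_
    (unitL2.massForm_centeredPrimitive_one hμ) unitL2.exists_eq_add_centeredPrimitive hlam v hv
  rw [massForm_one]
  exact ENNReal.toReal_pos hμ.ne' (measure_ne_top _ _)

/-- If the energy is at least `lam` times the mass for the functions which vanish at `n` points,
there are at most `n` eigenvalues smaller than `lam`. -/
theorem eigenvalueCount_le {μ : Measure ℝ} [IsFiniteMeasure μ] (hμ : 0 < μ (Icc 0 1))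
    {lam : ℝ} {ι : Type*} [Fintype ι] (p : ι → ℝ)
    (hp : ∀ y, (∀ i, ext y (p i) = 0) → lam * massForm μ y y ≤ energyForm y y) :
    eigenvalueCount μ lam ≤ Fintype.card ι := by
  rw [eigenvalueCount_eq]
  exact encard_pairLabels_le energyForm_comm (massForm_comm μ) (massForm_nonneg μ)
    (fun y h1 h2 => eq_zero_of_forms_eq_zero hμ h1 h2) (fun i => eval (p i)) hp

/-! ### Cell decompositions of a self-similar measure -/

/-- Nonoverlapping affine cells `x ↦ a i * x + b i` in `[0, 1]` with weights `ρ i` for which `μ₀`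
satisfies the self-similarity identity. -/
structure IsCellSystem (μ₀ : Measure ℝ) {ι : Type} [Fintype ι] (a b ρ : ι → ℝ) : Prop where
  ratio_ne_zero : ∀ i, a i ≠ 0
  weight_pos : ∀ i, 0 < ρ i
  mapsTo : ∀ i, MapsTo (fun x => a i * x + b i) (Icc 0 1) (Icc 0 1)
  disjoint : Pairwise fun i j => Disjoint
    ((fun x => a i * x + b i) '' Ioo 0 1) ((fun x => a j * x + b j) '' Ioo 0 1)
  invariant : ∀ E : Set ℝ, MeasurableSet E →
    μ₀ E = ∑ i, ENNReal.ofReal (ρ i) * μ₀ ((fun x => a i * x + b i) ⁻¹' E)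

theorem mapsTo_Ioo_of_mapsTo_Icc {a b : ℝ} (ha : a ≠ 0)
    (h : MapsTo (fun x => a * x + b) (Icc 0 1) (Icc 0 1)) :
    MapsTo (fun x => a * x + b) (Ioo 0 1) (Ioo 0 1) := by
  intro x hx
  have h0 := h (left_mem_Icc.2 zero_le_one)
  have h1 := h (right_mem_Icc.2 zero_le_one)
  simp only [mul_zero, zero_add, mul_one, mem_Icc] at h0 h1
  have hx0 := hx.1
  have hx1 := sub_pos.2 hx.2
  rcases ha.lt_or_gt with h2 | h2
  · constructor <;> nlinarith [mul_pos_of_neg_of_neg h2 (neg_neg_of_pos hx0),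
      mul_pos_of_neg_of_neg h2 (neg_neg_of_pos hx1)]
  · constructor <;> nlinarith [mul_pos h2 hx0, mul_pos h2 hx1]

namespace IsCellSystem

variable {μ₀ : Measure ℝ}

theorem trivial (μ₀ : Measure ℝ) :
    IsCellSystem μ₀ (ι := Unit) (fun _ => 1) (fun _ => 0) (fun _ => 1) where
  ratio_ne_zero _ := one_ne_zero
  weight_pos _ := one_pos
  mapsTo _ x hx := by simpa using hx
  disjoint i j h := absurd rfl h
  invariant E _ := by simp

/-- Each cell may be refined by a different system, which is what permits stopping branches at
different depths. -/
theorem comp {ι : Type} [Fintype ι] {a b ρ : ι → ℝ} (h : IsCellSystem μ₀ a b ρ)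
    {κ : ι → Type} [∀ i, Fintype (κ i)] {a' b' ρ' : ∀ i, κ i → ℝ}
    (h' : ∀ i, IsCellSystem μ₀ (a' i) (b' i) (ρ' i)) :
    IsCellSystem μ₀ (ι := Σ i, κ i) (fun p => a p.1 * a' p.1 p.2)
      (fun p => a p.1 * b' p.1 p.2 + b p.1) (fun p => ρ p.1 * ρ' p.1 p.2) := by
  have hcomp : ∀ p : Σ i, κ i,
      (fun x => a p.1 * a' p.1 p.2 * x + (a p.1 * b' p.1 p.2 + b p.1)) =
        (fun x => a p.1 * x + b p.1) ∘ (fun x => a' p.1 p.2 * x + b' p.1 p.2) := fun p => by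
    funext x
    simp only [Function.comp]
    ring
  refine ⟨fun p => mul_ne_zero (h.ratio_ne_zero _) ((h' _).ratio_ne_zero _),
    fun p => mul_pos (h.weight_pos _) ((h' _).weight_pos _), fun p => ?_, ?_, fun E hE => ?_⟩
  · rw [hcomp]
    exact (h.mapsTo _).comp ((h' _).mapsTo _)
  · rintro ⟨i, k⟩ ⟨j, l⟩ hne
    rw [hcomp ⟨i, k⟩, hcomp ⟨j, l⟩, image_comp, image_comp]
    by_cases hij : i = j
    · subst hij
      have hkl : k ≠ l := fun hkl => hne (by rw [hkl])
      refine ((h' i).disjoint hkl).image (u := univ) (fun x _ y _ hxy => ?_) (subset_univ _)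
        (subset_univ _)
      exact mul_left_cancel₀ (h.ratio_ne_zero i) (add_right_cancel hxy)
    · exact (h.disjoint hij).mono
        (image_mono (mapsTo_Ioo_of_mapsTo_Icc ((h' i).ratio_ne_zero k)
          ((h' i).mapsTo k)).image_subset)
        (image_mono (mapsTo_Ioo_of_mapsTo_Icc ((h' j).ratio_ne_zero l)
          ((h' j).mapsTo l)).image_subset)
  · rw [h.invariant E hE, Fintype.sum_sigma]
    refine Finset.sum_congr rfl fun i _ => ?_
    have hm : Measurable fun x => a i * x + b i := by fun_prop
    rw [(h' i).invariant _ (hm hE), Finset.mul_sum]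
    refine Finset.sum_congr rfl fun k _ => ?_
    rw [hcomp ⟨i, k⟩, preimage_comp, ENNReal.ofReal_mul (h.weight_pos i).le, mul_assoc]

theorem measure_eq {ι : Type} [Fintype ι] {a b ρ : ι → ℝ} (h : IsCellSystem μ₀ a b ρ) :
    μ₀ = ∑ i, ENNReal.ofReal (ρ i) • μ₀.map (fun x => a i * x + b i) := by
  ext E hE
  rw [h.invariant E hE, Measure.finsetSum_apply]
  refine Finset.sum_congr rfl fun i _ => ?_
  rw [Measure.smul_apply, Measure.map_apply (by fun_prop) hE, smul_eq_mul]

theorem integral_eq [IsFiniteMeasure μ₀] {ι : Type} [Fintype ι] {a b ρ : ι → ℝ}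
    (h : IsCellSystem μ₀ a b ρ) {f : ℝ → ℝ} (hf : Continuous f) {C : ℝ} (hC : ∀ x, |f x| ≤ C) :
    ∫ x, f x ∂μ₀ = ∑ i, ρ i * ∫ x, f (a i * x + b i) ∂μ₀ := by
  have hint : ∀ ν : Measure ℝ, IsFiniteMeasure ν → Integrable f ν := fun ν _ =>
    Integrable.of_bound hf.aestronglyMeasurable C (Filter.Eventually.of_forall hC)
  conv_lhs => rw [h.measure_eq]
  rw [integral_finsetSum_measure fun i _ => (hint _ inferInstance).smul_measure
    ENNReal.ofReal_ne_top]
  refine Finset.sum_congr rfl fun i _ => ?_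
  rw [integral_smul_measure, integral_map (by fun_prop) hf.aestronglyMeasurable,
    ENNReal.toReal_ofReal (h.weight_pos i).le, smul_eq_mul]

end IsCellSystem

/-! ### The exponent `D`, and the self-similar measure on the open interval -/

namespace AffineIFS

variable {m : ℕ} (F : AffineIFS m)

theorem abs_ratio_pos (i : Fin m) : 0 < |F.ratio i| := abs_pos.2 (F.ratio_ne_zero i)

theorem abs_ratio_lt_one (i : Fin m) : |F.ratio i| < 1 :=
  (Finset.single_le_sum (f := fun i => |F.ratio i|) (fun _ _ => abs_nonneg _)
    (Finset.mem_univ i)).trans_lt F.sum_abs_ratio_lt_one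

theorem weight_le_one (i : Fin m) : F.weight i ≤ 1 :=
  (Finset.single_le_sum (f := F.weight) (fun j _ => (F.weight_pos j).le)
    (Finset.mem_univ i)).trans_eq F.sum_weight

/-- The product of the weight and the length of a cell. -/
noncomputable def scale (i : Fin m) : ℝ := F.weight i * |F.ratio i|

theorem scale_pos (i : Fin m) : 0 < F.scale i := mul_pos (F.weight_pos i) (F.abs_ratio_pos i)

theorem scale_lt_one (i : Fin m) : F.scale i < 1 :=
  (mul_le_of_le_one_left (abs_nonneg _) (F.weight_le_one i)).trans_lt (F.abs_ratio_lt_one i)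

theorem strictAnti_sum_scale_rpow : StrictAnti fun s : ℝ => ∑ i, F.scale i ^ s := by
  intro s t hst
  have hm : 0 < m := two_pos.trans_le F.two_le
  exact Finset.sum_lt_sum_of_nonempty ⟨⟨0, hm⟩, Finset.mem_univ _⟩ fun i _ =>
    Real.rpow_lt_rpow_of_exponent_gt (F.scale_pos i) (F.scale_lt_one i) hst

/-- Cauchy–Schwarz applied to the roots of weights and lengths; total length below one makes the
bound strict. -/
theorem sum_scale_rpow_half_lt_one : ∑ i, F.scale i ^ (1 / 2 : ℝ) < 1 := by
  have h := Finset.sum_mul_sq_le_sq_mul_sq Finset.univ (fun i => √(F.weight i))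
    fun i => √|F.ratio i|
  have h1 : ∑ i, √(F.weight i) ^ 2 = 1 := by
    rw [← F.sum_weight]
    exact Finset.sum_congr rfl fun i _ => Real.sq_sqrt (F.weight_pos i).le
  have h2 : ∑ i, √|F.ratio i| ^ 2 < 1 := by
    refine lt_of_eq_of_lt (Finset.sum_congr rfl fun i _ => ?_) F.sum_abs_ratio_lt_one
    exact Real.sq_sqrt (abs_nonneg _)
  have h3 : ∑ i, F.scale i ^ (1 / 2 : ℝ) = ∑ i, √(F.weight i) * √|F.ratio i| :=
    Finset.sum_congr rfl fun i _ => by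
      rw [← Real.sqrt_eq_rpow, scale, Real.sqrt_mul (F.weight_pos i).le]
  rw [h1, one_mul] at h
  rw [h3]
  exact (sq_lt_one_iff₀ (Finset.sum_nonneg fun i _ => by positivity)).1 (h.trans_lt h2)

theorem exists_sum_scale_rpow_eq_one : ∃ D : ℝ, 0 < D ∧ D < 1 / 2 ∧ ∑ i, F.scale i ^ D = 1 := by
  have hcont : Continuous fun s : ℝ => ∑ i, F.scale i ^ s :=
    continuous_finsetSum _ fun i _ => Real.continuous_const_rpow (F.scale_pos i).ne'
  have h0 : (1 : ℝ) < ∑ i, F.scale i ^ (0 : ℝ) := by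
    simpa using lt_of_lt_of_le one_lt_two F.two_le
  obtain ⟨D, hD, hD1⟩ := intermediate_value_Ioo' (by norm_num : (0 : ℝ) ≤ 1 / 2)
    hcont.continuousOn ⟨F.sum_scale_rpow_half_lt_one, h0⟩
  exact ⟨D, hD.1, hD.2, hD1⟩

variable {F} {μ₀ : Measure ℝ}

theorem IsSelfSimilarMeasure.isCellSystem (hμ₀ : F.IsSelfSimilarMeasure μ₀) :
    IsCellSystem μ₀ F.ratio F.shift F.weight :=
  ⟨F.ratio_ne_zero, F.weight_pos, F.mapsTo, F.disjoint, hμ₀.invariant⟩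

theorem IsSelfSimilarMeasure.isProbabilityMeasure (hμ₀ : F.IsSelfSimilarMeasure μ₀) :
    IsProbabilityMeasure μ₀ := ⟨hμ₀.measure_univ⟩

/-- The interior of `[0, 1]` is charged by the self-similar measure. -/
theorem IsSelfSimilarMeasure.measure_Ioo_pos (hμ₀ : F.IsSelfSimilarMeasure μ₀) :
    0 < μ₀ (Ioo 0 1) := by
  by_contra! hle
  have hI : μ₀ (Ioo 0 1) = 0 := le_antisymm hle bot_le
  -- Since all weights are positive, each preimage of a null set is null, so atoms cannot be mapped
  -- into null sets.
  have key : ∀ E : Set ℝ, MeasurableSet E → μ₀ E = 0 → ∀ x, μ₀ {x} ≠ 0 → ∀ i, F.map i x ∉ E := by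
    intro E hE h0 x hx i hi
    have h1 := hμ₀.invariant E hE
    rw [h0, eq_comm, Finset.sum_eq_zero_iff] at h1
    have h2 := (mul_eq_zero.1 (h1 i (Finset.mem_univ i))).resolve_left
      (ENNReal.ofReal_pos.2 (F.weight_pos i)).ne'
    exact hx (measure_mono_null (singleton_subset_iff.2 hi) h2)
  have hend : ∀ x ∈ Icc (0 : ℝ) 1, μ₀ {x} ≠ 0 → ∀ i, F.map i x = 0 ∨ F.map i x = 1 := by
    intro x hx hx0 i
    have h1 := key _ measurableSet_Ioo hI x hx0 i
    have h2 : F.map i x ∈ Icc (0 : ℝ) 1 := F.mapsTo i hx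
    by_contra! h3
    exact h1 ⟨lt_of_le_of_ne h2.1 h3.1.symm, lt_of_le_of_ne h2.2 h3.2⟩
  have h0I : (0 : ℝ) ∈ Icc (0 : ℝ) 1 := ⟨le_rfl, zero_le_one⟩
  have h1I : (1 : ℝ) ∈ Icc (0 : ℝ) 1 := ⟨zero_le_one, le_rfl⟩
  let i₀ : Fin m := ⟨0, two_pos.trans_le F.two_le⟩
  let i₁ : Fin m := ⟨1, one_lt_two.trans_le F.two_le⟩
  have hne : i₀ ≠ i₁ := by simp [i₀, i₁]
  have hdj : ∀ x, x ∈ (fun x => F.ratio i₀ * x + F.shift i₀) '' Ioo 0 1 →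
      x ∉ (fun x => F.ratio i₁ * x + F.shift i₁) '' Ioo 0 1 := fun x h h' =>
    Set.disjoint_left.1 (F.disjoint hne) h h'
  have hdiff : ∀ i, F.map i 1 - F.map i 0 = F.ratio i := fun i => by simp [AffineIFS.map]
  have hlt : ∀ i, |F.map i 1 - F.map i 0| < 1 := fun i => by
    rw [hdiff]; exact F.abs_ratio_lt_one i
  have hrne : ∀ i, F.map i 1 - F.map i 0 ≠ 0 := fun i => by
    rw [hdiff]; exact F.ratio_ne_zero i
  -- An endpoint of `[0, 1]` which carries the full mass is fixed by all maps.
  by_cases h0 : μ₀ {0} = 0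
  · by_cases h1 : μ₀ {1} = 0
    · have : μ₀ univ = 0 := by
        refine measure_mono_null (t := (Icc 0 1)ᶜ ∪ (Ioo 0 1 ∪ ({0} ∪ {1}))) (fun x _ => ?_) ?_
        · by_cases hx : x ∈ Icc (0 : ℝ) 1
          · right
            rcases eq_or_lt_of_le hx.1 with h | h
            · exact Or.inr (Or.inl h.symm)
            · rcases eq_or_lt_of_le hx.2 with h' | h'
              · exact Or.inr (Or.inr h')
              · exact Or.inl ⟨h, h'⟩
          · exact Or.inl hx
        · exact measure_union_null hμ₀.measure_compl
            (measure_union_null hI (measure_union_null h0 h1))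
      rw [hμ₀.measure_univ] at this
      exact one_ne_zero this
    · have hfix : ∀ i, F.map i 1 = 1 := fun i =>
        (hend 1 h1I h1 i).resolve_left (key {0} (measurableSet_singleton 0) h0 1 h1 i)
      have hpos : ∀ i, 0 < F.ratio i := fun i => by
        refine lt_of_le_of_ne ?_ (F.ratio_ne_zero i).symm
        rw [← hdiff, hfix]
        exact sub_nonneg.2 (F.mapsTo i h0I).2
      have hr : 0 < min (F.ratio i₀) (F.ratio i₁) := lt_min (hpos _) (hpos _)
      -- All maps are increasing and fix `1`, so two of the open images share a point slightly to
      -- the left of `1`.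
      refine hdj (1 - min (F.ratio i₀) (F.ratio i₁) / 2)
        ⟨1 - min (F.ratio i₀) (F.ratio i₁) / 2 / F.ratio i₀, ?_, ?_⟩
        ⟨1 - min (F.ratio i₀) (F.ratio i₁) / 2 / F.ratio i₁, ?_, ?_⟩
      · refine ⟨sub_pos.2 ?_, sub_lt_self _ (div_pos (half_pos hr) (hpos _))⟩
        rw [div_lt_one (hpos _)]
        exact (half_lt_self hr).trans_le (min_le_left _ _)
      · have := hfix i₀
        have h3 := (hpos i₀).ne'
        simp only [AffineIFS.map] at this
        field_simp
        linarith
      · refine ⟨sub_pos.2 ?_, sub_lt_self _ (div_pos (half_pos hr) (hpos _))⟩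
        rw [div_lt_one (hpos _)]
        exact (half_lt_self hr).trans_le (min_le_right _ _)
      · have := hfix i₁
        have h3 := (hpos i₁).ne'
        simp only [AffineIFS.map] at this
        field_simp
        linarith
  · by_cases h1 : μ₀ {1} = 0
    · have hfix : ∀ i, F.map i 0 = 0 := fun i =>
        (hend 0 h0I h0 i).resolve_right (key {1} (measurableSet_singleton 1) h1 0 h0 i)
      have hpos : ∀ i, 0 < F.ratio i := fun i => by
        refine lt_of_le_of_ne ?_ (F.ratio_ne_zero i).symm
        rw [← hdiff, hfix, sub_zero]
        exact (F.mapsTo i h1I).1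
      have hr : 0 < min (F.ratio i₀) (F.ratio i₁) := lt_min (hpos _) (hpos _)
      have hs : ∀ i, F.shift i = 0 := fun i => by simpa [AffineIFS.map] using hfix i
      refine hdj (min (F.ratio i₀) (F.ratio i₁) / 2)
        ⟨min (F.ratio i₀) (F.ratio i₁) / 2 / F.ratio i₀, ⟨div_pos (half_pos hr) (hpos _), ?_⟩, ?_⟩
        ⟨min (F.ratio i₀) (F.ratio i₁) / 2 / F.ratio i₁, ⟨div_pos (half_pos hr) (hpos _), ?_⟩, ?_⟩
      · rw [div_lt_one (hpos _)]
        exact (half_lt_self hr).trans_le (min_le_left _ _)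
      · have h3 := (hpos i₀).ne'
        simp only [hs]
        field_simp
        simp
      · rw [div_lt_one (hpos _)]
        exact (half_lt_self hr).trans_le (min_le_right _ _)
      · have h3 := (hpos i₁).ne'
        simp only [hs]
        field_simp
        simp
    -- If both endpoints are atoms, each map sends the endpoints to endpoints, forcing `|ratio|` to
    -- be `0` or `1`.
    · have h2 := hlt i₀
      have h3 := hrne i₀
      rcases hend 0 h0I h0 i₀ with h | h <;> rcases hend 1 h1I h1 i₀ with h' | h' <;>
        simp [h, h'] at h2 h3

/-- Cell decompositions into cells of comparable scale. -/
theorem IsSelfSimilarMeasure.exists_isCellSystem (hμ₀ : F.IsSelfSimilarMeasure μ₀) {D : ℝ}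
    (hD : ∑ i, F.scale i ^ D = 1) {δ : ℝ} (hδ : 0 < δ) (hδ' : ∀ i, δ ≤ F.scale i)
    {ε : ℝ} (hε : 0 < ε) (hε' : δ * ε < 1) :
    ∃ (ι : Type) (_ : Fintype ι) (a b ρ : ι → ℝ), IsCellSystem μ₀ a b ρ ∧
      (∀ i, δ * ε < ρ i * |a i| ∧ ρ i * |a i| ≤ ε) ∧ ∑ i, (ρ i * |a i|) ^ D = 1 := by
  have hlarge : ∀ ε : ℝ, 1 ≤ ε → δ * ε < 1 →
      ∃ (ι : Type) (_ : Fintype ι) (a b ρ : ι → ℝ), IsCellSystem μ₀ a b ρ ∧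
      (∀ i, δ * ε < ρ i * |a i| ∧ ρ i * |a i| ≤ ε) ∧ ∑ i, (ρ i * |a i|) ^ D = 1 :=
    fun ε h1 h2 => ⟨Unit, inferInstance, _, _, _, IsCellSystem.trivial μ₀,
      fun i => by simpa using ⟨h2, h1⟩, by simp⟩
  have hm : 0 < m := two_pos.trans_le F.two_le
  obtain ⟨i₀, -, hi₀⟩ := Finset.exists_max_image Finset.univ F.scale
    ⟨⟨0, hm⟩, Finset.mem_univ _⟩
  -- The induction parameter bounds the depth: `i₀` has the largest scale, so `k` subdivisions bring
  -- every cell down to scale at most `ε`.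
  have key : ∀ k : ℕ, ∀ ε : ℝ, 0 < ε → δ * ε < 1 → F.scale i₀ ^ k ≤ ε →
      ∃ (ι : Type) (_ : Fintype ι) (a b ρ : ι → ℝ), IsCellSystem μ₀ a b ρ ∧
      (∀ i, δ * ε < ρ i * |a i| ∧ ρ i * |a i| ≤ ε) ∧ ∑ i, (ρ i * |a i|) ^ D = 1 := by
    intro k
    induction k with
    | zero => exact fun ε _ h1 h2 => hlarge ε (by simpa using h2) h1
    | succ k ih =>
      intro ε h0 h1 h2
      rcases le_or_gt 1 ε with h3 | h3
      · exact hlarge ε h3 h1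
      have hq := F.scale_pos
      -- Inside the cell `i` the target scale becomes `ε / F.scale i`. The condition `δ * ε < 1`
      -- survives because `ε < 1` and `δ ≤ F.scale i`.
      choose κ inst a' b' ρ' hsys hbd hsum using fun i => ih (ε / F.scale i) (div_pos h0 (hq i))
        (by
          rw [← mul_div_assoc, div_lt_one (hq i)]
          exact (mul_lt_of_lt_one_right hδ h3).trans_le (hδ' i))
        (by
          rw [le_div_iff₀ (hq i)]
          refine le_trans ?_ h2
          rw [pow_succ]
          exact mul_le_mul_of_nonneg_left (hi₀ i (Finset.mem_univ i)) (pow_pos (hq i₀) k).le)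
      have hmul : ∀ p : Σ i, κ i, F.weight p.1 * ρ' p.1 p.2 * |F.ratio p.1 * a' p.1 p.2| =
          F.scale p.1 * (ρ' p.1 p.2 * |a' p.1 p.2|) := fun p => by
        rw [abs_mul, scale]; ring
      refine ⟨Σ i, κ i, inferInstance, _, _, _, hμ₀.isCellSystem.comp hsys, fun p => ?_, ?_⟩
      · obtain ⟨h4, h5⟩ := hbd p.1 p.2
        rw [hmul]
        rw [← mul_div_assoc, div_lt_iff₀' (hq _)] at h4
        rw [le_div_iff₀' (hq _)] at h5
        exact ⟨h4, h5⟩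
      · simp only [hmul]
        rw [Fintype.sum_sigma, ← hD]
        refine Finset.sum_congr rfl fun i _ => ?_
        have : ∀ j, 0 ≤ ρ' i j * |a' i j| := fun j =>
          mul_nonneg ((hsys i).weight_pos j).le (abs_nonneg _)
        simp only [Real.mul_rpow (hq i).le (this _), ← Finset.mul_sum]
        rw [hsum i, mul_one]
  obtain ⟨k, hk⟩ := exists_pow_lt_of_lt_one hε (F.scale_lt_one i₀)
  exact key k ε hε hε' hk.le

end AffineIFS

/-! ### Deformations of the unit interval -/

namespace IsC1Diffeo

variable {g h : ℝ → ℝ}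

/-- The eigenvalue bounds use the smoothness of `g` only through this common constant `K`. Extending
by constants outside `[0, 1]` makes both maps globally Lipschitz. -/
theorem exists_lipschitz_extension (hg : IsC1Diffeo g h) :
    ∃ (K : NNReal) (G H : ℝ → ℝ), 1 ≤ K ∧ LipschitzWith K G ∧ LipschitzWith K H ∧
      EqOn G g (Icc 0 1) ∧ EqOn H h (Icc 0 1) := by
  have key : ∀ f : ℝ → ℝ, ContDiffOn ℝ 1 f (Icc 0 1) →
      ∃ (K : NNReal) (f' : ℝ → ℝ), LipschitzWith K f' ∧ EqOn f' f (Icc 0 1) := by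
    intro f hf
    obtain ⟨K, hK⟩ := hf.exists_lipschitzOnWith (by decide) (convex_Icc _ _) isCompact_Icc
    refine ⟨K * 1, IccExtend zero_le_one fun x => f x, ?_, fun x hx => IccExtend_of_mem _ _ hx⟩
    exact (lipschitzOnWith_iff_restrict.1 hK).comp (LipschitzWith.projIcc zero_le_one)
  obtain ⟨K₁, G, hG, hG'⟩ := key g hg.contDiffOn
  obtain ⟨K₂, H, hH, hH'⟩ := key h hg.contDiffOn_inv
  exact ⟨max 1 (max K₁ K₂), G, H, le_max_left _ _,
    hG.weaken ((le_max_left _ _).trans (le_max_right _ _)),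
    hH.weaken ((le_max_right _ _).trans (le_max_right _ _)), hG', hH'⟩

end IsC1Diffeo

theorem IsDeformedMeasure.eq_map {μ₀ μ : Measure ℝ} {g h H : ℝ → ℝ} (hμ : IsDeformedMeasure μ₀ g μ)
    (hg : IsC1Diffeo g h) (hμ₀ : μ₀ (Icc 0 1)ᶜ = 0) (hH : Measurable H)
    (hHh : EqOn H h (Icc 0 1)) : μ = μ₀.map H := by
  ext E hE
  have hset : g '' (E ∩ Icc 0 1) = H ⁻¹' E ∩ Icc 0 1 := by
    ext t
    constructor
    · rintro ⟨x, ⟨hxE, hx⟩, rfl⟩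
      refine ⟨?_, hg.mapsTo hx⟩
      rwa [mem_preimage, hHh (hg.mapsTo hx), hg.leftInv hx]
    · rintro ⟨htE, ht⟩
      rw [mem_preimage, hHh ht] at htE
      exact ⟨h t, ⟨htE, hg.mapsTo_inv ht⟩, hg.rightInv ht⟩
  rw [Measure.map_apply hH hE, ← measure_inter_add_sdiff E measurableSet_Icc,
    ← measure_inter_add_sdiff (H ⁻¹' E) measurableSet_Icc,
    measure_mono_null (sdiff_subset_compl E _) hμ.measure_compl,
    measure_mono_null (sdiff_subset_compl _ _) hμ₀,
    hμ.measure_eq _ inter_subset_right (hE.inter measurableSet_Icc), hset]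

/-! ### Upper bound for the counting function -/

open sobolevSpace

theorem sobolevSpace.exists_bound_ext (y : sobolevSpace) : ∃ C, ∀ x, |ext y x| ≤ C := by
  obtain ⟨C, hC⟩ := isCompact_Icc.exists_bound_of_continuousOn (continuousOn_ext y)
  refine ⟨C, fun x => ?_⟩
  have h := (projIcc (0 : ℝ) 1 zero_le_one x).2
  have h1 := hC _ h
  rw [ext_apply y h] at h1
  exact h1

section Bounds

variable {μ₀ μ : Measure ℝ} [IsFiniteMeasure μ] {g h G H : ℝ → ℝ}
  {K : NNReal} {ι : Type} [Fintype ι] {a b ρ : ι → ℝ}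

theorem massForm_self_eq_integral (hμc : μ (Icc 0 1)ᶜ = 0) (hμ : μ = μ₀.map H) (hH : Continuous H)
    (y : sobolevSpace) : massForm μ y y = ∫ t, ext y (H t) ^ 2 ∂μ₀ := by
  rw [massForm_self, Measure.restrict_eq_self_of_ae_mem (show ∀ᵐ x ∂μ, x ∈ Icc (0 : ℝ) 1 from hμc)]
  conv_lhs => rw [hμ]
  exact integral_map hH.aemeasurable ((continuous_ext y).pow 2).aestronglyMeasurable

/-- On the cell `i`, vanishing at one endpoint image bounds `y²` by `K * |a i|` times the energy on
that cell. The cell carries weight `ρ i`, and the cells are disjoint, so the contributions add up.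
-/
theorem massForm_le_energyForm (hsys : IsCellSystem μ₀ a b ρ) (hμ₀ : μ₀ univ = 1)
    (hμ₀c : μ₀ (Icc 0 1)ᶜ = 0) (hμc : μ (Icc 0 1)ᶜ = 0) (hμ : μ = μ₀.map H)
    (hH : LipschitzWith K H) (hHI : MapsTo H (Icc 0 1) (Icc 0 1)) (hHinj : InjOn H (Icc 0 1))
    {ε : ℝ} (hε : ∀ i, ρ i * |a i| ≤ ε) (y : sobolevSpace) (hy : ∀ i, ext y (H (b i)) = 0) :
    massForm μ y y ≤ K * ε * energyForm y y := by
  obtain ⟨C, hC⟩ := exists_bound_ext y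
  have : IsProbabilityMeasure μ₀ := ⟨hμ₀⟩
  have hcont : Continuous fun t => ext y (H t) ^ 2 := ((continuous_ext y).comp hH.continuous).pow 2
  have hbd : ∀ t, |ext y (H t) ^ 2| ≤ C ^ 2 := fun t => by
    rw [abs_pow]
    exact pow_le_pow_left₀ (abs_nonneg _) (hC _) 2
  rw [massForm_self_eq_integral hμc hμ hH.continuous, hsys.integral_eq hcont hbd]
  let ψ : ι → ℝ → ℝ := fun i t => H (a i * t + b i)
  let U : ι → Set ℝ := fun i => ψ i '' Ioo 0 1
  have hψc : ∀ i, Continuous (ψ i) := fun i => hH.continuous.comp (by fun_prop)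
  have hψinj : ∀ i, InjOn (ψ i) (Icc 0 1) := fun i s hs t ht hst =>
    mul_left_cancel₀ (hsys.ratio_ne_zero i)
      (add_right_cancel (hHinj (hsys.mapsTo i hs) (hsys.mapsTo i ht) hst))
  have hψI : ∀ i, MapsTo (ψ i) (Icc 0 1) (Icc 0 1) := fun i => hHI.comp (hsys.mapsTo i)
  have hUI : ∀ i, U i ⊆ Icc 0 1 := fun i =>
    ((hψI i).mono_left Ioo_subset_Icc_self).image_subset
  have hUm : ∀ i, MeasurableSet (U i) := fun i =>
    measurableSet_Ioo.image_of_continuousOn_injOn (hψc i).continuousOn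
      ((hψinj i).mono Ioo_subset_Icc_self)
  have hUd : Pairwise fun i j => Disjoint (U i) (U j) := by
    intro i j hij
    have h1 := hsys.disjoint hij
    have h2 : ∀ i, (fun x => a i * x + b i) '' Ioo 0 1 ⊆ Icc 0 1 := fun i =>
      ((hsys.mapsTo i).mono_left Ioo_subset_Icc_self).image_subset
    have h3 := h1.image hHinj (h2 i) (h2 j)
    rwa [← image_comp, ← image_comp] at h3
  have h0 : (0 : ℝ) ∈ Icc (0 : ℝ) 1 := ⟨le_rfl, zero_le_one⟩
  have hcell : ∀ i, ∀ t ∈ Icc (0 : ℝ) 1,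
      ext y (ψ i t) ^ 2 ≤ K * |a i| * ∫ x in U i, deriv (ext y) x ^ 2 := by
    intro i t ht
    have hseg : uIoo (ψ i 0) (ψ i t) ⊆ U i := by
      intro z hz
      have hz' : z ∈ ψ i '' uIcc 0 t :=
        intermediate_value_uIcc (hψc i).continuousOn (Ioo_subset_Icc_self hz)
      obtain ⟨s, hs, rfl⟩ := hz'
      rw [uIcc_of_le ht.1] at hs
      refine ⟨s, ⟨lt_of_le_of_ne hs.1 ?_, lt_of_lt_of_le (lt_of_le_of_ne hs.2 ?_) ht.2⟩, rfl⟩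
      · rintro rfl
        exact left_notMem_uIoo hz
      · rintro rfl
        exact right_notMem_uIoo hz
    have h1 := (memW12 y).sq_sub_le (hψI i ht) (hψI i h0) (hUI i) hseg
    have h2 : ext y (ψ i 0) = 0 := by simpa [ψ] using hy i
    rw [h2, sub_zero] at h1
    refine h1.trans (mul_le_mul_of_nonneg_right ?_ (integral_nonneg fun x => sq_nonneg _))
    have h3 := hH.dist_le_mul (a i * t + b i) (a i * 0 + b i)
    rw [Real.dist_eq, Real.dist_eq] at h3
    refine h3.trans (mul_le_mul_of_nonneg_left ?_ K.2)
    rw [show a i * t + b i - (a i * 0 + b i) = a i * t by ring, abs_mul, abs_of_nonneg ht.1]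
    exact mul_le_of_le_one_right (abs_nonneg _) ht.2
  have hint : ∀ i, ∫ t, ext y (ψ i t) ^ 2 ∂μ₀ ≤
      K * |a i| * ∫ x in U i, deriv (ext y) x ^ 2 := by
    intro i
    have h1 : ∫ t, ext y (ψ i t) ^ 2 ∂μ₀ ≤
        ∫ _, (K * |a i| * ∫ x in U i, deriv (ext y) x ^ 2) ∂μ₀ := by
      refine integral_mono_ae ?_ (integrable_const _) ?_
      · exact Integrable.of_bound (((continuous_ext y).comp (hψc i)).pow 2).aestronglyMeasurable
          (C ^ 2) (Filter.Eventually.of_forall fun t => hbd _)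
      · filter_upwards [show ∀ᵐ t ∂μ₀, t ∈ Icc (0 : ℝ) 1 from hμ₀c] with t ht using hcell i t ht
    simpa using h1
  have hsq : IntegrableOn (fun x => deriv (ext y) x ^ 2) (Icc 0 1) := by
    simpa only [sq] using integrable_deriv_mul_deriv y y
  calc _ ≤ ∑ i, K * ε * ∫ x in U i, deriv (ext y) x ^ 2 := by
        refine Finset.sum_le_sum fun i _ => ?_
        refine (mul_le_mul_of_nonneg_left (hint i) (hsys.weight_pos i).le).trans ?_
        rw [← mul_assoc, show ρ i * (K * |a i|) = K * (ρ i * |a i|) by ring]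
        exact mul_le_mul_of_nonneg_right (mul_le_mul_of_nonneg_left (hε i) K.2)
          (integral_nonneg fun x => sq_nonneg _)
    _ = K * ε * ∫ x in ⋃ i, U i, deriv (ext y) x ^ 2 := by
        rw [← Finset.mul_sum, integral_iUnion_fintype hUm hUd fun i => hsq.mono_set (hUI i)]
    _ ≤ K * ε * energyForm y y := by
        rcases isEmpty_or_nonempty ι with hι | ⟨⟨i⟩⟩
        -- An empty system would give `μ₀` total mass zero.
        · have := hsys.invariant univ MeasurableSet.univ
          simp at this
        have hε0 : 0 ≤ ε := le_trans (mul_nonneg (hsys.weight_pos i).le (abs_nonneg _)) (hε i)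
        rw [energyForm_self]
        refine mul_le_mul_of_nonneg_left ?_ (mul_nonneg K.2 hε0)
        exact setIntegral_mono_set hsq (Filter.Eventually.of_forall fun x => sq_nonneg _)
          (iUnion_subset hUI).eventuallyLE

/-! ### Lower bound for the counting function -/

/-- The tent function supported on `[0, 1]`. -/
noncomputable def tent (t : ℝ) : ℝ := max 0 (min t (1 - t))

theorem lipschitzWith_tent : LipschitzWith 1 tent := by
  have h1 : LipschitzWith 1 fun t : ℝ => 1 - t := by
    refine LipschitzWith.of_dist_le_mul fun x y => ?_
    rw [Real.dist_eq, Real.dist_eq, NNReal.coe_one, one_mul, abs_sub_comm]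
    exact le_of_eq (congrArg _ (by ring))
  have h2 : LipschitzWith 1 fun t : ℝ => max 0 (min t (1 - t)) := by
    simpa using (LipschitzWith.id.min h1).const_max 0
  exact h2

theorem tent_nonneg (t : ℝ) : 0 ≤ tent t := le_max_left _ _

theorem tent_le_one (t : ℝ) : tent t ≤ 1 := by
  rw [tent, max_le_iff, min_le_iff]
  refine ⟨zero_le_one, ?_⟩
  by_contra! h
  linarith [h.1, h.2]

theorem tent_pos {t : ℝ} : 0 < tent t ↔ t ∈ Ioo 0 1 := by
  simp [tent]

theorem tent_eq_zero {t : ℝ} (ht : t ∉ Ioo 0 1) : tent t = 0 :=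
  le_antisymm (not_lt.1 fun h => ht (tent_pos.1 h)) (tent_nonneg t)

/-- The tent function of a cell. -/
noncomputable def cellTent (G : ℝ → ℝ) (a b x : ℝ) : ℝ := tent ((G x - b) / a)

theorem lipschitzWith_cellTent (hG : LipschitzWith K G) (a b : ℝ) :
    LipschitzWith (K / ‖a‖₊) (cellTent G a b) := by
  have h1 : LipschitzWith (K / ‖a‖₊) fun x => (G x - b) / a := by
    refine LipschitzWith.of_dist_le_mul fun x y => ?_
    rw [Real.dist_eq, ← sub_div, sub_sub_sub_cancel_right, abs_div, NNReal.coe_div,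
      div_mul_eq_mul_div]
    exact div_le_div_of_nonneg_right (hG.dist_le_mul x y) (abs_nonneg a)
  have h2 := lipschitzWith_tent.comp h1
  rw [one_mul] at h2
  exact h2

/-- A zero of a nonnegative function is a minimum. Where the function is not differentiable, `deriv`
is zero by default, so kinks need no separate treatment. -/
theorem deriv_cellTent_eq_zero {a b x : ℝ} (hx : cellTent G a b x = 0) :
    deriv (cellTent G a b) x = 0 := by
  refine IsLocalMin.deriv_eq_zero (Filter.Eventually.of_forall fun z => ?_)
  rw [hx]
  exact tent_nonneg _

theorem mem_of_cellTent_ne_zero {a b x : ℝ} (ha : a ≠ 0) (hx : cellTent G a b x ≠ 0) :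
    G x ∈ (fun t => a * t + b) '' Ioo 0 1 := by
  refine ⟨(G x - b) / a, by_contra fun h => hx (tent_eq_zero h), ?_⟩
  field_simp
  ring

/-- The tent function of a cell as an element of the Sobolev space. -/
noncomputable def cellTentFun (hG : LipschitzWith K G) (a b : ℝ) : sobolevSpace :=
  ofMemW12 _ (MemW12.of_lipschitz (lipschitzWith_cellTent hG a b))

theorem ext_cellTentFun (hG : LipschitzWith K G) (a b : ℝ) :
    EqOn (ext (cellTentFun hG a b)) (cellTent G a b) (Icc 0 1) :=
  ext_ofMemW12 _

theorem energyForm_cellTentFun (hG : LipschitzWith K G) (a b a' b' : ℝ) :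
    energyForm (cellTentFun hG a b) (cellTentFun hG a' b') =
      ∫ x in Icc (0 : ℝ) 1, deriv (cellTent G a b) x * deriv (cellTent G a' b') x := by
  rw [energyForm_apply]
  refine integral_congr_ae ?_
  filter_upwards [deriv_ae_eq_of_eqOn_Icc (ext_cellTentFun hG a b),
    deriv_ae_eq_of_eqOn_Icc (ext_cellTentFun hG a' b')] with x h1 h2
  rw [h1, h2]

theorem cellTent_eq_zero_or (hsys : IsCellSystem μ₀ a b ρ) {i j : ι} (hij : i ≠ j) (x : ℝ) :
    cellTent G (a i) (b i) x = 0 ∨ cellTent G (a j) (b j) x = 0 := by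
  by_contra! h
  exact Set.disjoint_left.1 (hsys.disjoint hij)
    (mem_of_cellTent_ne_zero (hsys.ratio_ne_zero i) h.1)
    (mem_of_cellTent_ne_zero (hsys.ratio_ne_zero j) h.2)

theorem energyForm_cellTentFun_of_ne (hG : LipschitzWith K G) (hsys : IsCellSystem μ₀ a b ρ)
    {i j : ι} (hij : i ≠ j) :
    energyForm (cellTentFun hG (a i) (b i)) (cellTentFun hG (a j) (b j)) = 0 := by
  rw [energyForm_cellTentFun]
  refine integral_eq_zero_of_ae (Filter.Eventually.of_forall fun x => ?_)
  rcases cellTent_eq_zero_or (G := G) hsys hij x with h | h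
  · simp [deriv_cellTent_eq_zero h]
  · simp [deriv_cellTent_eq_zero h]

theorem massForm_cellTentFun_of_ne (hG : LipschitzWith K G) (hsys : IsCellSystem μ₀ a b ρ)
    {i j : ι} (hij : i ≠ j) :
    massForm μ (cellTentFun hG (a i) (b i)) (cellTentFun hG (a j) (b j)) = 0 := by
  rw [massForm_apply]
  refine setIntegral_eq_zero_of_forall_eq_zero fun x hx => ?_
  rw [ext_cellTentFun hG _ _ hx, ext_cellTentFun hG _ _ hx]
  exact mul_eq_zero.2 (cellTent_eq_zero_or hsys hij x)

/-- The slope is at most `K / |a|`, and on `[0, 1]` it is nonzero only within `K * |a|` of `H b`;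
the bound is slope squared times length. -/
theorem energyForm_cellTentFun_le (hG : LipschitzWith K G) (hH : LipschitzWith K H)
    (hHG : ∀ x ∈ Icc (0 : ℝ) 1, H (G x) = x) {a : ℝ} (ha : a ≠ 0) (b : ℝ) :
    energyForm (cellTentFun hG a b) (cellTentFun hG a b) ≤ 2 * K ^ 3 / |a| := by
  have ha' : 0 < |a| := abs_pos.2 ha
  rw [energyForm_cellTentFun]
  let V : Set ℝ := Icc (H b - K * |a|) (H b + K * |a|)
  have h1 : ∀ x ∈ Icc (0 : ℝ) 1, deriv (cellTent G a b) x * deriv (cellTent G a b) x ≤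
      V.indicator (fun _ => (K / |a|) ^ 2) x := by
    intro x hx
    by_cases hV : x ∈ V
    · rw [indicator_of_mem hV, ← sq, ← sq_abs]
      have h2 := norm_deriv_le_of_lipschitz (lipschitzWith_cellTent hG a b) (x₀ := x)
      exact pow_le_pow_left₀ (abs_nonneg _) (by simpa using h2) 2
    · rw [indicator_of_notMem hV, deriv_cellTent_eq_zero, mul_zero]
      by_contra h2
      obtain ⟨s, hs, hGx⟩ := mem_of_cellTent_ne_zero ha h2
      refine hV ?_
      have h3 := hH.dist_le_mul (G x) b
      rw [hHG x hx, ← hGx, Real.dist_eq, Real.dist_eq, add_sub_cancel_right, abs_mul,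
        abs_of_pos hs.1] at h3
      have h4 : (K : ℝ) * (|a| * s) ≤ K * |a| :=
        mul_le_mul_of_nonneg_left (mul_le_of_le_one_right ha'.le hs.2.le) K.2
      have h5 := abs_le.1 (h3.trans h4)
      exact ⟨by linarith [h5.1], by linarith [h5.2]⟩
  have hVint : Integrable (V.indicator fun _ => ((K : ℝ) / |a|) ^ 2) volume :=
    (integrable_indicator_iff measurableSet_Icc).2
      (integrableOn_const (by rw [Real.volume_Icc]; exact ENNReal.ofReal_ne_top))
  calc _ ≤ ∫ x in Icc (0 : ℝ) 1, V.indicator (fun _ => ((K : ℝ) / |a|) ^ 2) x := by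
        refine setIntegral_mono_on ?_ hVint.integrableOn measurableSet_Icc h1
        have h2 := MemW12.of_lipschitz (lipschitzWith_cellTent hG a b)
        exact h2.2.integrable_mul h2.2
    _ ≤ ∫ x, V.indicator (fun _ => ((K : ℝ) / |a|) ^ 2) x :=
        setIntegral_le_integral hVint (Filter.Eventually.of_forall fun x =>
          indicator_nonneg (fun _ _ => sq_nonneg _) x)
    _ = 2 * K ^ 3 / |a| := by
        rw [integral_indicator measurableSet_Icc, setIntegral_const, Real.volume_real_Icc_of_le
          (by nlinarith [mul_nonneg K.2 ha'.le]), smul_eq_mul]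
        field_simp
        ring

/-- Only the `i`-th term of the self-similarity identity is kept; there the tent rescales to the
standard one. -/
theorem le_massForm_cellTentFun [IsFiniteMeasure μ₀] (hsys : IsCellSystem μ₀ a b ρ)
    (hμ₀c : μ₀ (Icc 0 1)ᶜ = 0)
    (hμc : μ (Icc 0 1)ᶜ = 0) (hμ : μ = μ₀.map H) (hG : LipschitzWith K G) (hH : LipschitzWith K H)
    (hHI : MapsTo H (Icc 0 1) (Icc 0 1)) (hGH : ∀ x ∈ Icc (0 : ℝ) 1, G (H x) = x) (i : ι) :
    ρ i * ∫ t, tent t ^ 2 ∂μ₀ ≤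
      massForm μ (cellTentFun hG (a i) (b i)) (cellTentFun hG (a i) (b i)) := by
  have h1 : massForm μ (cellTentFun hG (a i) (b i)) (cellTentFun hG (a i) (b i)) =
      ∫ t, tent ((t - b i) / a i) ^ 2 ∂μ₀ := by
    rw [massForm_self_eq_integral hμc hμ hH.continuous]
    refine integral_congr_ae ?_
    filter_upwards [show ∀ᵐ t ∂μ₀, t ∈ Icc (0 : ℝ) 1 from hμ₀c] with t ht
    rw [ext_cellTentFun hG _ _ (hHI ht), cellTent, hGH t ht]
  have hcont : Continuous fun t => tent ((t - b i) / a i) ^ 2 :=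
    (lipschitzWith_tent.continuous.comp (by fun_prop)).pow 2
  rw [h1, hsys.integral_eq hcont (C := 1) fun x => by
    rw [abs_pow, abs_of_nonneg (tent_nonneg _)]
    exact pow_le_one₀ (tent_nonneg _) (tent_le_one _)]
  refine le_trans (le_of_eq ?_) (Finset.single_le_sum
    (f := fun j => ρ j * ∫ t, tent ((a j * t + b j - b i) / a i) ^ 2 ∂μ₀)
    (fun j _ => mul_nonneg (hsys.weight_pos j).le (integral_nonneg fun t => sq_nonneg _))
    (Finset.mem_univ i))
  simp only [add_sub_cancel_right, mul_div_cancel_left₀ _ (hsys.ratio_ne_zero i)]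

/-- Tents of distinct cells do not overlap, so both forms are diagonal on their span, and `hε` says
that every tent has Rayleigh quotient below `lam`. -/
theorem card_le_eigenvalueCount [IsFiniteMeasure μ₀] (hsys : IsCellSystem μ₀ a b ρ)
    (hμ₀c : μ₀ (Icc 0 1)ᶜ = 0)
    (hμc : μ (Icc 0 1)ᶜ = 0) (hμ1 : 0 < μ (Icc 0 1)) (hμ : μ = μ₀.map H) (hG : LipschitzWith K G)
    (hH : LipschitzWith K H) (hHI : MapsTo H (Icc 0 1) (Icc 0 1))
    (hGH : ∀ x ∈ Icc (0 : ℝ) 1, G (H x) = x) (hHG : ∀ x ∈ Icc (0 : ℝ) 1, H (G x) = x)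
    {lam : ℝ} (hlam : 0 < lam)
    (hε : ∀ i, 2 * K ^ 3 < lam * (∫ t, tent t ^ 2 ∂μ₀) * (ρ i * |a i|)) :
    (Fintype.card ι : ℕ∞) ≤ eigenvalueCount μ lam := by
  classical
  let y : ι → sobolevSpace := fun i => cellTentFun hG (a i) (b i)
  have hexp : ∀ B : sobolevSpace →ₗ[ℝ] sobolevSpace →ₗ[ℝ] ℝ,
      (∀ i j, i ≠ j → B (y i) (y j) = 0) → ∀ c : ι → ℝ,
      B (Fintype.linearCombination ℝ y c) (Fintype.linearCombination ℝ y c) =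
        ∑ i, c i ^ 2 * B (y i) (y i) := by
    intro B hB c
    simp only [Fintype.linearCombination_apply, map_sum, LinearMap.sum_apply, map_smul,
      LinearMap.smul_apply, smul_eq_mul]
    refine Finset.sum_congr rfl fun i _ => ?_
    rw [Finset.sum_eq_single i (fun j _ hj => by rw [hB j i hj, mul_zero]) (by simp)]
    ring
  refine le_eigenvalueCount hμ1 hlam (Fintype.linearCombination ℝ y) fun c hc => ?_
  rw [hexp _ (fun i j hij => energyForm_cellTentFun_of_ne hG hsys hij),
    hexp _ (fun i j hij => massForm_cellTentFun_of_ne hG hsys hij), Finset.mul_sum]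
  have hlt : ∀ i, energyForm (y i) (y i) < lam * massForm μ (y i) (y i) := by
    intro i
    have ha := abs_pos.2 (hsys.ratio_ne_zero i)
    refine (energyForm_cellTentFun_le hG hH hHG (hsys.ratio_ne_zero i) (b i)).trans_lt ?_
    refine lt_of_lt_of_le ?_ (mul_le_mul_of_nonneg_left
      (le_massForm_cellTentFun hsys hμ₀c hμc hμ hG hH hHI hGH i) hlam.le)
    rw [div_lt_iff₀ ha]
    refine (hε i).trans_eq ?_
    ring
  obtain ⟨i, hi⟩ := Function.ne_iff.1 hc
  have hi' : c i ≠ 0 := hi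
  refine Finset.sum_lt_sum (fun j _ => ?_) ⟨i, Finset.mem_univ i, ?_⟩
  · rw [mul_left_comm]
    exact mul_le_mul_of_nonneg_left (hlt j).le (sq_nonneg _)
  · rw [mul_left_comm]
    exact mul_lt_mul_of_pos_left (hlt i) (by positivity)

theorem one_le_eigenvalueCount (hμ : 0 < μ (Icc 0 1)) {lam : ℝ} (hlam : 0 < lam) :
    1 ≤ eigenvalueCount μ lam := by
  have h1 : 0 < μ.real (Icc 0 1) := ENNReal.toReal_pos hμ.ne' (measure_ne_top _ _)
  have h := le_eigenvalueCount hμ hlam (ι := Unit)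
    ((LinearMap.proj ()).smulRight sobolevOne) fun c hc => by
      have hc' : c () ≠ 0 := fun h0 => hc (funext fun _ => h0)
      simp only [LinearMap.smulRight_apply, LinearMap.proj_apply, map_smul, LinearMap.smul_apply,
        energyForm_one, massForm_one, smul_eq_mul, mul_zero]
      have := mul_self_pos.2 hc'
      have h2 := mul_pos hlam (mul_pos this h1)
      linarith [h2, mul_assoc (c ()) (c ()) (μ.real (Icc 0 1))]
  simpa using h

end Bounds

theorem AffineIFS.IsSelfSimilarMeasure.integral_tent_pos {m : ℕ} {F : AffineIFS m} {μ₀ : Measure ℝ}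
    (hμ₀ : F.IsSelfSimilarMeasure μ₀) : 0 < ∫ t, tent t ^ 2 ∂μ₀ := by
  have := hμ₀.isProbabilityMeasure
  rw [integral_pos_iff_support_of_nonneg (fun t => sq_nonneg _)]
  · refine hμ₀.measure_Ioo_pos.trans_le (measure_mono fun t ht => ?_)
    exact pow_ne_zero 2 (tent_pos.2 ht).ne'
  · refine Integrable.of_bound (lipschitzWith_tent.continuous.pow 2).aestronglyMeasurable 1
      (Filter.Eventually.of_forall fun t => ?_)
    rw [Real.norm_eq_abs, abs_pow, abs_of_nonneg (tent_nonneg _)]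
    exact pow_le_one₀ (tent_nonneg _) (tent_le_one _)

/-! ### The spectral asymptotics -/

/-- The derivative of the conjugate of an affine map at its fixed point. -/
theorem AffineIFS.hasDerivWithinAt_deformedMap {m : ℕ} (F : AffineIFS m) {g h : ℝ → ℝ}
    (hg : IsC1Diffeo g h) {i : Fin m} {x : ℝ} (hxI : x ∈ Icc (0 : ℝ) 1)
    (hx : F.deformedMap g h i x = x) :
    HasDerivWithinAt (F.deformedMap g h i) (F.ratio i) (Icc 0 1) x := by
  have hS : MapsTo (F.map i) (Icc 0 1) (Icc 0 1) := F.mapsTo i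
  have hz : F.map i (g x) = g x := by
    have h1 := congrArg g hx
    rwa [AffineIFS.deformedMap, Function.comp_apply, Function.comp_apply,
      hg.rightInv (hS (hg.mapsTo hxI))] at h1
  have hgd := ((hg.contDiffOn.differentiableOn one_ne_zero) x hxI).hasDerivWithinAt
  have hhd := ((hg.contDiffOn_inv.differentiableOn one_ne_zero) (g x)
    (hg.mapsTo hxI)).hasDerivWithinAt
  set g' := derivWithin g (Icc 0 1) x
  set h' := derivWithin h (Icc 0 1) (g x)
  -- Since `F.map i` fixes `g x`, the derivatives of `g` and `h` are taken at matching points and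
  -- cancel.
  have hprod : h' * g' = 1 := by
    have h1 : HasDerivWithinAt (h ∘ g) (h' * g') (Icc 0 1) x := hhd.comp x hgd hg.mapsTo
    have h2 : HasDerivWithinAt (h ∘ g) 1 (Icc 0 1) x :=
      (hasDerivWithinAt_id x _).congr (fun t ht => hg.leftInv ht) (hg.leftInv hxI)
    exact (uniqueDiffOn_Icc zero_lt_one x hxI).eq_deriv _ h1 h2
  have hSd : HasDerivWithinAt (F.map i) (F.ratio i) (Icc 0 1) (g x) := by
    have h1 := (((hasDerivAt_id (g x)).const_mul (F.ratio i)).add_const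
      (F.shift i)).hasDerivWithinAt (s := Icc 0 1)
    rwa [mul_one] at h1
  have h1 : HasDerivWithinAt (F.map i ∘ g) (F.ratio i * g') (Icc 0 1) x :=
    hSd.comp x hgd hg.mapsTo
  have hhd' : HasDerivWithinAt h h' (Icc 0 1) ((F.map i ∘ g) x) := by
    rwa [Function.comp_apply, hz]
  have h2 : HasDerivWithinAt (h ∘ (F.map i ∘ g)) (h' * (F.ratio i * g')) (Icc 0 1) x :=
    hhd'.comp x h1 (hS.comp hg.mapsTo)
  rw [show h' * (F.ratio i * g') = F.ratio i by linear_combination F.ratio i * hprod] at h2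
  exact h2

/-- The growth rate of the counting function of the deformed measure. -/
theorem eigenvalueCount_asymp {m : ℕ} {F : AffineIFS m} {μ₀ : Measure ℝ}
    (hμ₀ : F.IsSelfSimilarMeasure μ₀) {g h : ℝ → ℝ} (hg : IsC1Diffeo g h) {μ : Measure ℝ}
    [IsFiniteMeasure μ] (hμ : IsDeformedMeasure μ₀ g μ) {D : ℝ} (hD0 : 0 < D)
    (hD : ∑ i, F.scale i ^ D = 1) :
    ∃ C₁ C₂ : ℝ, 0 < C₁ ∧ 0 < C₂ ∧
      (∀ lam : ℝ, 0 ≤ lam → ENNReal.ofReal (C₁ * lam ^ D) ≤ (eigenvalueCount μ lam : ℝ≥0∞)) ∧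
      (∀ lam : ℝ, 1 ≤ lam → (eigenvalueCount μ lam : ℝ≥0∞) ≤ ENNReal.ofReal (C₂ * lam ^ D)) := by
  have := hμ₀.isProbabilityMeasure
  obtain ⟨K, G, H, hK1, hG, hH, hGg, hHh⟩ := hg.exists_lipschitz_extension
  have hmap : μ = μ₀.map H :=
    hμ.eq_map hg hμ₀.measure_compl hH.continuous.measurable hHh
  have hHI : MapsTo H (Icc 0 1) (Icc 0 1) := fun t ht => by
    rw [hHh ht]; exact hg.mapsTo_inv ht
  have hGH : ∀ t ∈ Icc (0 : ℝ) 1, G (H t) = t := fun t ht => by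
    rw [hHh ht, hGg (hg.mapsTo_inv ht), hg.rightInv ht]
  have hHG : ∀ x ∈ Icc (0 : ℝ) 1, H (G x) = x := fun x hx => by
    rw [hGg hx, hHh (hg.mapsTo hx), hg.leftInv hx]
  have hHinj : InjOn H (Icc 0 1) := fun s hs t ht hst => by
    rw [← hGH s hs, ← hGH t ht, hst]
  have hμ1 : 0 < μ (Icc 0 1) := by
    have h1 : μ univ = 1 := by
      rw [hmap, Measure.map_apply hH.continuous.measurable MeasurableSet.univ, preimage_univ,
        hμ₀.measure_univ]
    rw [pos_iff_ne_zero]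
    intro h0
    have h2 : μ univ ≤ μ (Icc 0 1) + μ (Icc 0 1)ᶜ := by
      rw [← union_compl_self (Icc (0 : ℝ) 1)]
      exact measure_union_le _ _
    rw [h0, hμ.measure_compl, h1, add_zero] at h2
    exact one_ne_zero (le_antisymm h2 bot_le)
  obtain ⟨i₀, -, hi₀⟩ := Finset.exists_min_image Finset.univ F.scale
    ⟨⟨0, two_pos.trans_le F.two_le⟩, Finset.mem_univ _⟩
  set δ := F.scale i₀
  have hδ0 : 0 < δ := F.scale_pos i₀
  have hδ1 : δ < 1 := F.scale_lt_one i₀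
  have hδ : ∀ i, δ ≤ F.scale i := fun i => hi₀ i (Finset.mem_univ i)
  have hK : (1 : ℝ) ≤ K := by exact_mod_cast hK1
  have hK0 : (0 : ℝ) < K := one_pos.trans_le hK
  set κ := ∫ t, tent t ^ 2 ∂μ₀
  have hκ : 0 < κ := hμ₀.integral_tent_pos
  -- A cell of scale greater than `P / lam` carries a tent with Rayleigh quotient below `lam`.
  set P := 2 * (K : ℝ) ^ 3 / κ with hP
  have hP0 : 0 < P := by positivity
  refine ⟨(δ / P) ^ D, (K / δ) ^ D, by positivity, by positivity, fun lam hlam => ?_,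
    fun lam hlam => ?_⟩
  · rcases eq_or_lt_of_le hlam with h0 | h0
    · rw [← h0, Real.zero_rpow hD0.ne', mul_zero, ENNReal.ofReal_zero]
      exact bot_le
    rw [← Real.mul_rpow (by positivity) hlam]
    -- For `lam ≤ P` the claimed bound is at most one, and the eigenvalue zero already supplies it.
    rcases le_or_gt lam P with hle | hgt
    · calc ENNReal.ofReal ((δ / P * lam) ^ D) ≤ ENNReal.ofReal 1 := by
            refine ENNReal.ofReal_le_ofReal (Real.rpow_le_one (by positivity) ?_ hD0.le)
            rw [div_mul_eq_mul_div, div_le_one hP0]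
            exact (mul_le_of_le_one_left hlam hδ1.le).trans hle
        _ = ((1 : ℕ∞) : ℝ≥0∞) := by simp
        _ ≤ _ := ENat.toENNReal_mono (one_le_eigenvalueCount hμ1 h0)
    -- The choice `ε = P / (δ * lam)` puts the lower end `δ * ε` of the range of scales exactly at
    -- `P / lam`.
    · have hε : 0 < P / (δ * lam) := by positivity
      have hδε : δ * (P / (δ * lam)) = P / lam := by field_simp
      obtain ⟨ι, _, a, b, ρ, hsys, hbd, hsum⟩ := hμ₀.exists_isCellSystem hD hδ0 hδ hε
        (by rwa [hδε, div_lt_one h0])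
      have hcard := card_le_eigenvalueCount hsys hμ₀.measure_compl hμ.measure_compl hμ1 hmap hG hH
        hHI hGH hHG h0 fun i => by
          have h1 := (hbd i).1
          rw [hδε, div_lt_iff₀ h0, hP, div_lt_iff₀ hκ] at h1
          refine h1.trans_eq ?_
          ring
      have hle : (1 : ℝ) ≤ Fintype.card ι * (P / (δ * lam)) ^ D := by
        rw [← hsum]
        refine (Finset.sum_le_card_nsmul _ _ ((P / (δ * lam)) ^ D) fun i _ => ?_).trans_eq ?_
        · exact Real.rpow_le_rpow (mul_nonneg (hsys.weight_pos i).le (abs_nonneg _)) (hbd i).2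
            hD0.le
        · rw [nsmul_eq_mul, Finset.card_univ]
      have hinv : (δ / P * lam) ^ D = ((P / (δ * lam)) ^ D)⁻¹ := by
        rw [← Real.inv_rpow hε.le]
        congr 1
        field_simp
      calc ENNReal.ofReal ((δ / P * lam) ^ D) ≤ ENNReal.ofReal (Fintype.card ι) := by
            refine ENNReal.ofReal_le_ofReal ?_
            rw [hinv]
            exact (inv_le_iff_one_le_mul₀ (by positivity)).2 hle
        _ = ((Fintype.card ι : ℕ∞) : ℝ≥0∞) := by simp
        _ ≤ _ := ENat.toENNReal_mono hcard
  · have h0 : 0 < lam := one_pos.trans_le hlam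
    have hKl : 1 ≤ K * lam := one_le_mul_of_one_le_of_one_le hK hlam
    -- With `ε = 1 / (K * lam)`, the factor `K * ε` between mass and energy is exactly `1 / lam`.
    have hε : 0 < 1 / (K * lam) := by positivity
    have hε1 : 1 / (K * lam) ≤ 1 := by rwa [div_le_one (by positivity)]
    obtain ⟨ι, _, a, b, ρ, hsys, hbd, hsum⟩ := hμ₀.exists_isCellSystem hD hδ0 hδ hε
      ((mul_le_of_le_one_right hδ0.le hε1).trans_lt hδ1)
    have hcard := eigenvalueCount_le hμ1 (lam := lam) (fun i => H (b i)) fun y hy => by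
      have h1 := massForm_le_energyForm hsys hμ₀.measure_univ hμ₀.measure_compl hμ.measure_compl
        hmap hH hHI hHinj (fun i => (hbd i).2) y hy
      refine (mul_le_mul_of_nonneg_left h1 h0.le).trans_eq ?_
      field_simp
    have hle : Fintype.card ι * (δ * (1 / (K * lam))) ^ D ≤ (1 : ℝ) := by
      rw [← Finset.card_univ, ← nsmul_eq_mul]
      exact (Finset.card_nsmul_le_sum _ _ _ fun i _ =>
        Real.rpow_le_rpow (by positivity) (hbd i).1.le hD0.le).trans_eq hsum
    have hinv : (K / δ) ^ D * lam ^ D = ((δ * (1 / (K * lam))) ^ D)⁻¹ := by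
      rw [← Real.mul_rpow (by positivity) h0.le, ← Real.inv_rpow (by positivity)]
      congr 1
      field_simp
    calc (eigenvalueCount μ lam : ℝ≥0∞) ≤ ((Fintype.card ι : ℕ∞) : ℝ≥0∞) :=
          ENat.toENNReal_mono hcard
      _ = ENNReal.ofReal (Fintype.card ι) := by simp
      _ ≤ _ := by
          refine ENNReal.ofReal_le_ofReal ?_
          rw [hinv]
          exact (le_inv_mul_iff₀ (by positivity)).2 (by rwa [mul_comm]) |>.trans_eq (mul_one _)

theorem corollary2 {m : ℕ} (F : AffineIFS m) (μ₀ : Measure ℝ) (hμ₀ : F.IsSelfSimilarMeasure μ₀)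
    (g h : ℝ → ℝ) (hg : IsC1Diffeo g h)
    (μ : Measure ℝ) [IsFiniteMeasure μ] (hμ : IsDeformedMeasure μ₀ g μ)
    (x : Fin m → ℝ) (hxI : ∀ i, x i ∈ Icc (0 : ℝ) 1)
    (hx : ∀ i, F.deformedMap g h i (x i) = x i) :
    (∀ i, DifferentiableWithinAt ℝ (F.deformedMap g h i) (Icc 0 1) (x i) ∧
      |derivWithin (F.deformedMap g h i) (Icc 0 1) (x i)| = |F.ratio i|) ∧
    ∃ D : ℝ, 0 < D ∧ D < 1 / 2 ∧
      ∑ i, (F.weight i * |derivWithin (F.deformedMap g h i) (Icc 0 1) (x i)|) ^ D = 1 ∧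
      (∀ s : ℝ,
        ∑ i, (F.weight i * |derivWithin (F.deformedMap g h i) (Icc 0 1) (x i)|) ^ s = 1 → s = D) ∧
      ∃ C₁ C₂ : ℝ, 0 < C₁ ∧ 0 < C₂ ∧
        (∀ lam : ℝ, 0 ≤ lam →
          ENNReal.ofReal (C₁ * lam ^ D) ≤ (eigenvalueCount μ lam : ℝ≥0∞)) ∧
        (∀ lam : ℝ, 1 ≤ lam →
          (eigenvalueCount μ lam : ℝ≥0∞) ≤ ENNReal.ofReal (C₂ * lam ^ D)) := by
  have hd := fun i => F.hasDerivWithinAt_deformedMap hg (hxI i) (hx i)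
  have hd' : ∀ i, derivWithin (F.deformedMap g h i) (Icc 0 1) (x i) = F.ratio i := fun i =>
    (hd i).derivWithin (uniqueDiffOn_Icc zero_lt_one _ (hxI i))
  obtain ⟨D, hD0, hD2, hD⟩ := F.exists_sum_scale_rpow_eq_one
  refine ⟨fun i => ⟨(hd i).differentiableWithinAt, by rw [hd' i]⟩, D, hD0, hD2, ?_, fun s hs => ?_,
    eigenvalueCount_asymp hμ₀ hg hμ hD0 hD⟩
  · simp only [hd']
    exact hD
  · simp only [hd'] at hs
    exact F.strictAnti_sum_scale_rpow.injective (hs.trans hD.symm)
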